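/- Let $p\neq q$ be primes, let $K/\mathbb{Q}_p$ be an unramified extension of finite degree $m$ with ring of integers $\mathcal{O}_K$, let $v$ be the valuation on $K$ with $v(p)=1$, and for $x\in K^\times$ call $p^{-v(x)}x\in\mathcal{O}_K^\times$ the unit part of $x$. Let $\zeta\in K$ be a primitive $(p^m-1)$-th root of unity and $d=\gcd(q,p^m-1)$. Let $f\in\mathcal{O}_K[x]$ be a polynomial of degree $q$ that is irreducible over $K$, with roots $\theta_1,\dots,\theta_q$ in an algebraic closure $\overline{K}$, let $\theta$ be one of these roots, and put $\Delta_f=\prod_{i<j}(\theta_i-\theta_j)^2\in K^\times$ (for monic $f$ this is the discriminant of $f$; in general it is the discriminant of $f$ divided by its leading coefficient). Let $u$ be the unit part of $\Delta_f$. 1. $q(q-1)\mid v(\Delta_f)$ if and only if $K(\theta)/K$ is the unique unramified extension of degree $q$ of $K$ inside $\overline{K}$. 2. If $q(q-1)\nmid v(\Delta_f)$, then $q-1$ divides $v(\Delta_f)$ and $\frac{v(\Delta_f)}{q-1}$ is prime to $q$. For every integer $\ell$ that is inverse to $\frac{v(\Delta_f)}{q-1}$ modulo $q$, the integers $r$ for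 which $\zeta^r u^\ell$ is congruent to a $q$-th power modulo $p\mathcal{O}_K$ form exactly one residue class modulo $d$, and for every such $r$ there is an isomorphism $K(\theta)\cong K\big(\sqrt[q]{\zeta^r p}\big)$ of extensions of $K$, for any choice of the $q$-th root in $\overline{K}$. -/

import Mathlib

open Polynomial IntermediateField

namespace PadicExt

noncomputable section

/-- The ring of integers `𝒪_K` of an extension `K` of `ℚ_p`: the integral closure of `ℤ_p` in `K`. -/
abbrev ringOfIntegers (p : ℕ) [Fact p.Prime] (K : Type*) [Field K] [Algebra ℤ_[p] K] :
    Subalgebra ℤ_[p] K :=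
  integralClosure ℤ_[p] K

/-- An algebraic extension `L / F`, where `F` is the fraction field of an integrally closed domain
`A`, is unramified (relative to `A`) if the integral closure of `A` in `L` is unramified
over `A`. -/
def IsUnramifiedExt (A L : Type*) [CommRing A] [Field L] [Algebra A L] : Prop :=
  Algebra.FormallyUnramified A (integralClosure A L)

/-- The `p`-adic valuation on `K`, normalized by `v(p) = 1`, for `K / ℚ_p` finite and unramified:
`v(x)` is the largest integer `n` with `x ∈ p ^ n 𝒪_K` (for `x ≠ 0`; the junk value at `0`
is `0`). -/
def val (p : ℕ) [Fact p.Prime] {K : Type*} [Field K] [Algebra ℤ_[p] K] (x : K) : ℤ :=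
  sSup {n : ℤ | ∃ a : ringOfIntegers p K, x = (p : K) ^ n * (a : K)}

/-- The unit part `p ^ (-v(x)) x` of `x`. -/
def unitPart (p : ℕ) [Fact p.Prime] {K : Type*} [Field K] [Algebra ℤ_[p] K] (x : K) : K :=
  (p : K) ^ (-val p x) * x

/-- `x` lies in `𝒪_K` and is congruent to an `n`-th power modulo `p 𝒪_K`. -/
def IsPowModP (p : ℕ) [Fact p.Prime] {K : Type*} [Field K] [Algebra ℤ_[p] K]
    (n : ℕ) (x : K) : Prop :=
  ∃ c a : ringOfIntegers p K, x = (c : K) ^ n + (p : K) * (a : K)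

/-- The discriminant `∏_{i<j} (θ_i - θ_j) ^ 2` of the roots of `f`, that is, the discriminant of the
monic polynomial proportional to `f`. For monic `f` it is the discriminant of `f`. -/
def rootDiscr {K : Type*} [Field K] (f : K[X]) : K :=
  (C f.leadingCoeff⁻¹ * f).discr

end

end PadicExt

/-! Extend the `p`-adic absolute value to the algebraic closure. Conjugates over `K` then have equal
value, and since `K` is unramified its nonzero values are the powers of `c = |p|`. Let `F = K(θ)`.
Translation by `K` changes neither `F` nor the discriminant, so `θ` may be replaced by `x = θ - a`
with `a ∈ K` a best approximation. Taking norms, `|x|^q = c^s` for an integer `s`, and everything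
depends on whether `q ∣ s` (`HasValues.unramified_or_ramified`).

If `q ∣ s`, scaling `x` by a power of `p` gives a unit whose residue lies outside the residue field
of `K`. Hensel's lemma lifts that residue to a root of unity generating `F`. Its distinct conjugates
are incongruent, hence so are those of the scaled `x`: the discriminant is a unit times a power of
`p` with exponent divisible by `q(q-1)`, and `F` is unramified. Uniqueness holds because roots of
unity of order prime to `p` are determined by the size of the residue field.

If `q ∤ s`, the residue field does not grow. As `q ≠ p`, principal units are `q`-th powers, so a
principal unit carries `x` to a radical `β` with `β^q = p^s b`, `b` a unit of `K`. Differences of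
conjugates of `x` and of `β` agree up to principal units, so `Δ` agrees up to a principal unit with
`±q^q (p^s b)^(q-1)`, the discriminant of `X^q - p^s b` (`HasValues.exists_radical_discr`). Hence
`v(Δ) = s(q-1)`, and `u b` is a `q`-th power up to a principal unit. Thus `u` determines `b` modulo
`q`-th powers, and for `sℓ ≡ 1` mod `q` a multiple of `β^ℓ` is a `q`-th root of `ζ^r p`
(`HasValues.exists_radical_eq`). -/

namespace PadicExt

open scoped NNReal
open Finset (range univ)

/-! ### Principal units and sums of elements with distinct values -/

section Valuation

variable {Ω : Type*} [Field Ω] (v : Valuation Ω ℝ≥0)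

/-- The multiplicative monoid of the elements congruent to `1` modulo the maximal ideal of a
valuation. -/
def principalUnits : Submonoid Ω where
  carrier := {x | v (x - 1) < 1}
  one_mem' := by simp
  mul_mem' := by
    intro a b ha hb
    have ha' : v a = 1 := by
      rw [← v.map_one]; exact v.map_eq_of_sub_lt (by simpa using ha)
    have : a * b - 1 = a * (b - 1) + (a - 1) := by ring
    change v (a * b - 1) < 1
    rw [this]
    exact v.map_add_lt (by simpa [ha'] using hb) ha

variable {v}

lemma mem_principalUnits {x : Ω} : x ∈ principalUnits v ↔ v (x - 1) < 1 := Iff.rfl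

lemma val_eq_one_of_mem {x : Ω} (hx : x ∈ principalUnits v) : v x = 1 := by
  rw [← v.map_one]; exact v.map_eq_of_sub_lt (by rw [v.map_one]; exact hx)

lemma div_mem_principalUnits_iff {x y : Ω} (hy : y ≠ 0) :
    x / y ∈ principalUnits v ↔ v (x - y) < v y := by
  rw [mem_principalUnits, div_sub_one hy, map_div₀, div_lt_one₀]
  exact pos_iff_ne_zero.2 (v.ne_zero_iff.2 hy)

lemma inv_mem_principalUnits {x : Ω} (hx : x ∈ principalUnits v) : x⁻¹ ∈ principalUnits v := by
  have h1 := val_eq_one_of_mem hx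
  have h0 : x ≠ 0 := by rintro rfl; simp at h1
  rw [← one_div, div_mem_principalUnits_iff h0, v.map_sub_swap, h1]
  exact hx

lemma zpow_mem_principalUnits {x : Ω} (hx : x ∈ principalUnits v) (n : ℤ) :
    x ^ n ∈ principalUnits v := by
  cases n with
  | ofNat n => simpa using pow_mem hx n
  | negSucc n => simpa using inv_mem_principalUnits (pow_mem hx (n + 1))

lemma ne_zero_of_val_eq_one {x : Ω} (hx : v x = 1) : x ≠ 0 := by rintro rfl; simp at hx

/-- If `w ≠ 1`, then `1 + w + ⋯ + w^(n-1) = 0`; but every term is congruent to `1`, so the sum is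
congruent to the unit `n`. -/
lemma eq_one_of_pow_eq_one {n : ℕ} (hn : v n = 1) {w : Ω} (hw : w ^ n = 1)
    (h : w ∈ principalUnits v) : w = 1 := by
  by_contra hne
  have h0 : ∑ i ∈ range n, w ^ i = 0 := by
    have := geom_sum_mul w n
    rw [hw, sub_self, mul_eq_zero] at this
    exact this.resolve_right (sub_ne_zero.2 hne)
  have h1 : v (∑ i ∈ range n, (w ^ i - 1)) < 1 :=
    v.map_sum_lt one_ne_zero fun i _ => pow_mem h i
  rw [Finset.sum_sub_distrib, h0] at h1
  simp [hn] at h1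

/-- Roots of unity of order prime to the residue characteristic are determined by their residue
classes; more generally, so are `n`-th roots of a given unit. -/
lemma eq_of_pow_eq_pow {n : ℕ} (hn : v n = 1) {x y : Ω} (hy : y ≠ 0) (hxy : x ^ n = y ^ n)
    (h : v (x - y) < v y) : x = y := by
  rw [← div_eq_one_iff_eq hy]
  refine eq_one_of_pow_eq_one hn ?_ ((div_mem_principalUnits_iff hy).2 h)
  rw [div_pow, hxy, div_self (pow_ne_zero _ hy)]

lemma exists_lt_one_of_prod_lt_one {ι : Type*} {s : Multiset ι} {f : ι → Ω}
    (h : v (s.map f).prod < 1) : ∃ i ∈ s, v (f i) < 1 := by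
  by_contra! hc
  refine h.not_ge ?_
  refine Multiset.prod_induction (fun x => 1 ≤ v x) _ (fun a b ha hb => ?_) (by simp) ?_
  · rw [map_mul]; exact one_le_mul ha hb
  · simpa using hc

/-- A sum whose nonzero terms have distinct valuations dominates each of its terms. -/
lemma val_le_val_sum {ι : Type*} {s : Finset ι} {f : ι → Ω}
    (h : ∀ i ∈ s, ∀ j ∈ s, f i ≠ 0 → v (f i) = v (f j) → i = j) {i : ι} (hi : i ∈ s) :
    v (f i) ≤ v (∑ j ∈ s, f j) := by
  classical
  obtain ⟨k, hk, hmax⟩ := s.exists_max_image (fun j => v (f j)) ⟨i, hi⟩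
  refine (hmax i hi).trans ?_
  by_cases h0 : f k = 0
  · simp [h0]
  have : v (∑ j ∈ s.erase k, f j) < v (f k) := by
    refine v.map_sum_lt (v.ne_zero_iff.2 h0) fun j hj => ?_
    rw [Finset.mem_erase] at hj
    exact lt_of_le_of_ne (hmax j hj.2) fun e => hj.1 (h k hk j hj.2 h0 e.symm).symm
  rw [← Finset.add_sum_erase s f hk, v.map_add_eq_of_lt_left this]

end Valuation

/-! ### Conjugation-invariant valuations and Hensel's lemma -/

section Conj

variable {Ω : Type*} [Field Ω] (v : Valuation Ω ℝ≥0) (K : Type*) [Field K] [Algebra K Ω]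

/-- A valuation is conjugation invariant if conjugate elements have the same value. -/
def IsConjInvariant : Prop := ∀ x y : Ω, IsConjRoot K x y → v x = v y

variable {v K} (hv : IsConjInvariant v K)
variable {F : Type*} [Field F] [Algebra K F] [Algebra F Ω] [IsScalarTower K F Ω]
include hv

lemma IsConjInvariant.algHom_apply (σ : F →ₐ[K] Ω) (x : F) :
    v (σ x) = v (algebraMap F Ω x) :=
  hv _ _ (by
    rw [IsConjRoot, minpoly.algHom_eq _ σ.injective,
      minpoly.algebraMap_eq (algebraMap F Ω).injective])

variable [IsAlgClosed Ω] [Algebra.IsAlgebraic K Ω] [CharZero K]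

/-- Hensel's lemma for `n`-th roots. -/
lemma IsConjInvariant.exists_pow_eq {n : ℕ} (hn : v n = 1) {z y : F}
    (hz : v (algebraMap F Ω z) = 1) (h : v (algebraMap F Ω (z ^ n - y)) < 1) :
    ∃ x : F, x ^ n = y ∧ v (algebraMap F Ω (x - z)) < 1 := by
  have hn0 : n ≠ 0 := by rintro rfl; simp at hn
  set i := algebraMap F Ω
  have hchar : CharZero F := charZero_of_injective_algebraMap (algebraMap K F).injective
  have : Algebra.IsAlgebraic F Ω := Algebra.IsAlgebraic.tower_top (K := K) F
  have : IsAlgClosure F Ω := ⟨inferInstance, inferInstance⟩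
  have hsp : (X ^ n - C (i y) : Polynomial Ω).Splits := IsAlgClosed.splits _
  have he := hsp.eval_eq_prod_roots (i z)
  rw [leadingCoeff_X_pow_sub_C (Nat.pos_of_ne_zero hn0), one_mul] at he
  -- The product of `z - b` over all roots `b` of `X^n - y` has value below `1`, so some factor
  -- does.
  obtain ⟨b, hb, hzb⟩ : ∃ b ∈ (X ^ n - C (i y) : Polynomial Ω).roots, v (i z - b) < 1 := by
    apply exists_lt_one_of_prod_lt_one
    rw [← he]
    simpa using h
  have hbn : b ^ n = i y := by
    have := (mem_roots'.1 hb).2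
    simpa [sub_eq_zero] using this
  have hvb : v b = 1 := by
    rw [← hz]; exact v.map_eq_of_sub_lt (by rw [hz, v.map_sub_swap]; exact hzb)
  -- Descent to `F` by Galois theory: `σ b` is again an `n`-th root of `y` close to `z`, and there
  -- is only one such root.
  obtain ⟨x, rfl⟩ : b ∈ Set.range i := by
    rw [InfiniteGalois.mem_range_algebraMap_iff_fixed]
    intro σ
    refine eq_of_pow_eq_pow hn (ne_zero_of_val_eq_one hvb) ?_ ?_
    · rw [← map_pow, hbn]; exact σ.commutes y
    · have h1 : v (i z - σ b) < 1 := by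
        have : i z - σ b = σ (i z - b) := by rw [map_sub]; congr 1; exact (σ.commutes z).symm
        rw [this]
        have := hv.algHom_apply (F := Ω) ((σ : Ω →ₐ[F] Ω).restrictScalars K) (i z - b)
        simp only [Algebra.algebraMap_self, RingHom.id_apply] at this
        exact this.trans_lt hzb
      rw [hvb]
      have : σ b - b = (i z - b) - (i z - σ b) := by ring
      rw [this]
      exact v.map_sub_lt hzb h1
  refine ⟨x, ?_, ?_⟩
  · apply i.injective; rw [map_pow, hbn]
  · rw [map_sub, v.map_sub_swap]; exact hzb

lemma IsConjInvariant.exists_pow_eq_of_mem {n : ℕ} (hn : v n = 1) {y : F}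
    (h : algebraMap F Ω y ∈ principalUnits v) :
    ∃ x : F, x ^ n = y ∧ algebraMap F Ω x ∈ principalUnits v := by
  obtain ⟨x, hx, hx'⟩ := hv.exists_pow_eq hn (z := (1 : F)) (y := y) (by simp)
    (by rw [one_pow, map_sub, map_one, v.map_sub_swap]; exact h)
  exact ⟨x, hx, by rwa [map_sub, map_one] at hx'⟩

end Conj

/-! ### Embeddings, discriminants and differences of conjugates -/

section Conjugates

variable {K F Ω : Type*} [Field K] [Field F] [Field Ω] [Algebra K F] [Algebra K Ω]

lemma adjoin_eq_top_of_notMem_range (hF : (Module.finrank K F).Prime) {t : F}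
    (ht : t ∉ Set.range (algebraMap K F)) : K⟮t⟯ = ⊤ := by
  have := isSimpleOrder_of_finrank_prime K F hF
  refine (eq_bot_or_eq_top K⟮t⟯).resolve_left fun h => ht ?_
  rw [adjoin_simple_eq_bot_iff, mem_bot] at h
  exact h

variable [FiniteDimensional K F] [CharZero K]

lemma algHom_injective_of_adjoin_eq_top [IsAlgClosed Ω] {t : F} (ht : K⟮t⟯ = ⊤) :
    Function.Injective fun σ : F →ₐ[K] Ω => σ t :=
  (Field.primitive_element_iff_algHom_eq_of_eval' K Ω (fun _ => IsAlgClosed.splits _) t).1 ht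

lemma aroots_minpoly [IsAlgClosed Ω] {t : F} (ht : K⟮t⟯ = ⊤) :
    (minpoly K t).aroots Ω = (univ : Finset (F →ₐ[K] Ω)).val.map fun σ => σ t := by
  have hint : IsIntegral K t := Algebra.IsIntegral.isIntegral t
  symm
  apply Multiset.eq_of_le_of_card_le
  · rw [Multiset.le_iff_subset]
    · intro x hx
      obtain ⟨σ, -, rfl⟩ := Multiset.mem_map.1 hx
      rw [mem_aroots]
      exact ⟨minpoly.ne_zero hint, by rw [aeval_algHom_apply, minpoly.aeval, map_zero]⟩
    · exact (Multiset.nodup_map_iff_of_injective (algHom_injective_of_adjoin_eq_top ht)).2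
        univ.nodup
  · rw [Multiset.card_map, Finset.card_val, Finset.card_univ, AlgHom.card K F Ω]
    refine (card_roots' _).trans ?_
    rw [natDegree_map, ← (Field.primitive_element_iff_minpoly_natDegree_eq K t).1 ht]

lemma nonempty_algEquiv_adjoin_of_aeval_eq_zero [IsAlgClosed Ω] {t : F} (ht : K⟮t⟯ = ⊤) {α : Ω}
    (hα : aeval α (minpoly K t) = 0) : Nonempty (F ≃ₐ[K] K⟮α⟯) := by
  have h : α ∈ (minpoly K t).aroots Ω :=
    mem_aroots.2 ⟨minpoly.ne_zero (Algebra.IsIntegral.isIntegral t), hα⟩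
  rw [aroots_minpoly ht] at h
  obtain ⟨σ, -, rfl⟩ := Multiset.mem_map.1 h
  have : σ.fieldRange = K⟮σ t⟯ := by
    rw [AlgHom.fieldRange_eq_map, ← ht, adjoin_map, Set.image_singleton]
  exact ⟨(AlgEquiv.ofInjectiveField σ).trans (equivOfEq this)⟩

open scoped Classical in
variable (K Ω) in
/-- The product of all differences `σ t - τ t` over ordered pairs of distinct embeddings. -/
noncomputable def diffProd (t : F) : Ω :=
  ∏ σ : F →ₐ[K] Ω, ∏ τ ∈ univ.erase σ, (σ t - τ t)

lemma aeval_derivative_minpoly [IsAlgClosed Ω] [DecidableEq (F →ₐ[K] Ω)] {t : F} (ht : K⟮t⟯ = ⊤)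
    (σ : F →ₐ[K] Ω) :
    aeval (σ t) (minpoly K t).derivative = ∏ τ ∈ univ.erase σ, (σ t - τ t) := by
  classical
  have hinj : Function.Injective fun σ : F →ₐ[K] Ω => σ t := algHom_injective_of_adjoin_eq_top ht
  have hsp : ((minpoly K t).map (algebraMap K Ω)).Splits := IsAlgClosed.splits _
  have hm : ((minpoly K t).map (algebraMap K Ω)).Monic :=
    (minpoly.monic (Algebra.IsIntegral.isIntegral t)).map _
  have hr := aroots_minpoly (Ω := Ω) ht
  rw [← eval_map_algebraMap, ← derivative_map, hsp.eval_root_derivative hm (x := σ t)]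
  · have := Multiset.map_erase (fun σ : F →ₐ[K] Ω => σ t) hinj σ univ.val
    rw [aroots_def] at hr
    rw [hr, ← this, Multiset.map_map]
    rfl
  · rw [← aroots_def, hr]
    exact Multiset.mem_map_of_mem _ (Finset.mem_univ σ)

/-- The discriminant is, up to this sign, the resultant of the polynomial with its derivative, that
is, the product of the derivative's values at the roots. -/
lemma algebraMap_discr_minpoly [IsAlgClosed Ω] {t : F} (ht : K⟮t⟯ = ⊤) :
    algebraMap K Ω (minpoly K t).discr =
      (-1) ^ (Module.finrank K F * (Module.finrank K F - 1) / 2) * diffProd K Ω t := by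
  classical
  have hint : IsIntegral K t := Algebra.IsIntegral.isIntegral t
  have hd := (Field.primitive_element_iff_minpoly_natDegree_eq K t).1 ht
  have h1 := resultant_deriv (minpoly.degree_pos hint)
  rw [(minpoly.monic hint).leadingCoeff, mul_one, hd] at h1
  have h2 : (minpoly K t).discr = (-1) ^ (Module.finrank K F * (Module.finrank K F - 1) / 2) *
      resultant (minpoly K t) (minpoly K t).derivative (Module.finrank K F)
        (Module.finrank K F - 1) := by
    rw [h1, ← mul_assoc, ← mul_pow]; simp
  rw [h2, map_mul, map_pow, map_neg, map_one, ← resultant_map_map]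
  congr 1
  have hnd : ((minpoly K t).map (algebraMap K Ω)).natDegree = Module.finrank K F := by
    rw [natDegree_map, hd]
  have h3 := resultant_eq_prod_eval ((minpoly K t).map (algebraMap K Ω))
    ((minpoly K t).derivative.map (algebraMap K Ω)) (Module.finrank K F - 1)
    (by rw [natDegree_map, ← hd]; exact natDegree_derivative_le _) (IsAlgClosed.splits _)
  rw [hnd] at h3
  rw [h3, ((minpoly.monic hint).map _).leadingCoeff, one_pow, one_mul, ← aroots_def,
    aroots_minpoly ht, Multiset.map_map, diffProd]
  refine Finset.prod_congr rfl fun σ _ => ?_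
  rw [← aeval_derivative_minpoly ht σ, Function.comp_apply, eval_map_algebraMap]

omit [CharZero K] in
lemma diffProd_sub_algebraMap (t : F) (a : K) :
    diffProd K Ω (t - algebraMap K F a) = diffProd K Ω t := by
  simp [diffProd]

lemma diffProd_algebraMap_mul [IsAlgClosed Ω] (t : F) (a : K) :
    diffProd K Ω (algebraMap K F a * t) =
      algebraMap K Ω a ^ (Module.finrank K F * (Module.finrank K F - 1)) * diffProd K Ω t := by
  classical
  simp only [diffProd, map_mul, AlgHom.commutes, ← mul_sub, Finset.prod_mul_distrib,
    Finset.prod_const, Finset.mem_univ, Finset.card_erase_of_mem, Finset.card_univ,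
    AlgHom.card K F Ω]
  rw [← pow_mul, mul_comm (Module.finrank K F - 1)]

lemma val_diffProd [IsAlgClosed Ω] {v : Valuation Ω ℝ≥0} {t : F} {r : ℝ≥0}
    (h : ∀ σ τ : F →ₐ[K] Ω, σ ≠ τ → v (σ t - τ t) = r) :
    v (diffProd K Ω t) = r ^ (Module.finrank K F * (Module.finrank K F - 1)) := by
  classical
  have : ∀ σ : F →ₐ[K] Ω, ∏ τ ∈ univ.erase σ, v (σ t - τ t) = r ^ (Module.finrank K F - 1) := by
    intro σ
    rw [Finset.prod_congr rfl fun τ hτ => h σ τ (Finset.ne_of_mem_erase hτ).symm,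
      Finset.prod_const, Finset.card_erase_of_mem (Finset.mem_univ _), Finset.card_univ,
      AlgHom.card K F Ω]
  simp only [diffProd, map_prod, this, Finset.prod_const, Finset.card_univ, AlgHom.card K F Ω]
  rw [← pow_mul, mul_comm (Module.finrank K F - 1)]

omit [CharZero K] in
/-- If the conjugates of `x` and `y` have congruent differences, then their products of differences
are congruent. -/
lemma diffProd_div_mem {v : Valuation Ω ℝ≥0} {x y : F}
    (h : ∀ σ τ : F →ₐ[K] Ω, σ ≠ τ → (σ x - τ x) / (σ y - τ y) ∈ principalUnits v) :
    diffProd K Ω x / diffProd K Ω y ∈ principalUnits v := by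
  classical
  rw [diffProd, diffProd, ← Finset.prod_div_distrib]
  refine prod_mem fun σ _ => ?_
  rw [← Finset.prod_div_distrib]
  exact prod_mem fun τ hτ => h σ τ (Finset.ne_of_mem_erase hτ).symm

end Conjugates

/-! ### Value groups and best approximation from the base field -/

section Approximation

variable {K F Ω : Type*} [Field K] [Field F] [Field Ω] [Algebra K F] [Algebra K Ω] [Algebra F Ω]

/-- The nonzero elements of `F` have values in the cyclic group generated by `c`. -/
def HasValues (F : Type*) [Field F] [Algebra F Ω] (v : Valuation Ω ℝ≥0) (c : ℝ≥0) : Prop :=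
  ∀ x : F, x ≠ 0 → ∃ n : ℤ, v (algebraMap F Ω x) = c ^ n

variable {v : Valuation Ω ℝ≥0} {c : ℝ≥0}

lemma HasValues.dvd_of_pow_eq (hF : HasValues F v c) (hc0 : 0 < c) (hc1 : c < 1) {n : ℕ}
    (hn : n ≠ 0) {x : F} {s : ℤ} (hx : v (algebraMap F Ω x) ^ n = c ^ s) : (n : ℤ) ∣ s := by
  have hx0 : x ≠ 0 := by
    rintro rfl
    rw [map_zero, map_zero, zero_pow hn] at hx
    exact (zpow_pos hc0 s).ne hx
  obtain ⟨k, hk⟩ := hF x hx0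
  rw [hk, ← zpow_natCast, ← zpow_mul] at hx
  exact ⟨k, by rw [mul_comm]; exact (zpow_right_injective₀ hc0 hc1.ne hx).symm⟩

variable [IsScalarTower K F Ω] [FiniteDimensional K F] [CharZero K] [IsAlgClosed Ω]

lemma IsConjInvariant.val_pow_finrank (hv : IsConjInvariant v K) (x : F) :
    v (algebraMap F Ω x) ^ Module.finrank K F = v (algebraMap K Ω (Algebra.norm K x)) := by
  rw [Algebra.norm_eq_prod_embeddings, map_prod, Finset.prod_congr rfl
    fun σ _ => hv.algHom_apply σ x, Finset.prod_const, Finset.card_univ, AlgHom.card K F Ω]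

lemma HasValues.exists_pow_finrank (hK : HasValues K v c) (hv : IsConjInvariant v K) {x : F}
    (hx : x ≠ 0) : ∃ n : ℤ, v (algebraMap F Ω x) ^ Module.finrank K F = c ^ n := by
  rw [hv.val_pow_finrank]
  exact hK _ (Algebra.norm_ne_zero_iff.2 hx)

/-- An element of `F` outside of `K` has a best approximation in `K`. -/
lemma HasValues.exists_best_approx [Algebra.IsAlgebraic K Ω] (hK : HasValues K v c)
    (hv : IsConjInvariant v K) (hc0 : 0 < c) (hc1 : c < 1) {θ : F}
    (hθ : θ ∉ Set.range (algebraMap K F)) :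
    ∃ a : K, ∀ b : K, v (algebraMap F Ω (θ - algebraMap K F a)) ≤
      v (algebraMap F Ω (θ - algebraMap K F b)) := by
  have hn : Module.finrank K F ≠ 0 := Module.finrank_pos.ne'
  have hne : ∀ a : K, θ - algebraMap K F a ≠ 0 := fun a h => hθ ⟨a, (sub_eq_zero.1 h).symm⟩
  obtain ⟨σ, hσ⟩ : ∃ σ : F →ₐ[K] Ω, σ θ ≠ algebraMap F Ω θ := by
    by_contra! h
    have : IsAlgClosure K Ω := ⟨inferInstance, inferInstance⟩
    obtain ⟨a, ha⟩ : algebraMap F Ω θ ∈ Set.range (algebraMap K Ω) := by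
      rw [InfiniteGalois.mem_range_algebraMap_iff_fixed]
      exact fun τ => h ((τ : Ω →ₐ[K] Ω).comp (IsScalarTower.toAlgHom K F Ω))
    refine hθ ⟨a, (algebraMap F Ω).injective ?_⟩
    rw [← ha, ← IsScalarTower.algebraMap_apply]
  -- Krasner-type bound: `θ - a` and its conjugate have equal value, so neither can be smaller than
  -- their difference `σ θ - θ`, which does not depend on `a`.
  have hδ : ∀ a : K, v (σ θ - algebraMap F Ω θ) ≤ v (algebraMap F Ω (θ - algebraMap K F a)) := by
    intro a
    have h1 := hv.algHom_apply σ (θ - algebraMap K F a)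
    have : σ θ - algebraMap F Ω θ =
        σ (θ - algebraMap K F a) - algebraMap F Ω (θ - algebraMap K F a) := by
      rw [map_sub, map_sub, AlgHom.commutes, ← IsScalarTower.algebraMap_apply]; ring
    rw [this]
    exact v.map_sub_le h1.le le_rfl
  have hδ0 : 0 < v (σ θ - algebraMap F Ω θ) :=
    pos_iff_ne_zero.2 (v.ne_zero_iff.2 (sub_ne_zero.2 hσ))
  obtain ⟨N, hN⟩ := exists_pow_lt_of_lt_one (pow_pos hδ0 (Module.finrank K F)) hc1
  -- The `q`-th powers of the distances (`q = [F : K]`) are integral powers of `c` with exponents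
  -- bounded above, so a largest exponent, hence a least distance, is attained.
  obtain ⟨n, ⟨a, ha⟩, hmax⟩ := Int.exists_greatest_of_bdd
    (P := fun n => ∃ a : K, v (algebraMap F Ω (θ - algebraMap K F a)) ^ Module.finrank K F = c ^ n)
    ⟨N, fun z ⟨a, ha⟩ => by
      by_contra! hz
      have h1 := (zpow_lt_zpow_right_of_lt_one₀ hc0 hc1 hz)
      rw [← ha, zpow_natCast] at h1
      exact (h1.trans hN).not_ge (pow_le_pow_left₀ zero_le (hδ a) _)⟩
    (by
      obtain ⟨n, hn⟩ := hK.exists_pow_finrank hv (hne 0)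
      exact ⟨n, 0, hn⟩)
  refine ⟨a, fun b => ?_⟩
  obtain ⟨k, hk⟩ := hK.exists_pow_finrank hv (hne b)
  rw [← pow_le_pow_iff_left₀ zero_le zero_le hn, ha, hk]
  exact zpow_le_zpow_right_of_le_one₀ hc0 hc1.le (hmax k ⟨b, hk⟩)

end Approximation

/-! ### Extensions of prime degree: roots of unity and radicals -/

section PrimeDegree

variable {K F Ω : Type*} [Field K] [Field F] [Field Ω] [Algebra K F] [Algebra K Ω] [Algebra F Ω]
  [IsScalarTower K F Ω] [FiniteDimensional K F] [CharZero K] [IsAlgClosed Ω]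
  [Algebra.IsAlgebraic K Ω] {v : Valuation Ω ℝ≥0} {c : ℝ≥0}

omit [CharZero K] in
lemma exists_powerBasis {t : F} (ht : K⟮t⟯ = ⊤) :
    ∃ pb : PowerBasis K F, pb.gen = t ∧ pb.dim = Module.finrank K F := by
  have hint : IsIntegral K t := Algebra.IsIntegral.isIntegral t
  have h : Algebra.adjoin K {t} = ⊤ := by
    rw [← adjoin_simple_toSubalgebra_of_isAlgebraic hint.isAlgebraic, ht, top_toSubalgebra]
  exact ⟨PowerBasis.ofAdjoinEqTop hint h, by simp, (PowerBasis.finrank _).symm⟩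

/-- If the residue class of `w` is not in the residue field of `K` but has multiplicative order
prime to the residue characteristic, then `F` is generated by a root of unity lifting it, and the
conjugates of `w` are pairwise incongruent. -/
lemma IsConjInvariant.exists_rootOfUnity (hv : IsConjInvariant v K)
    (hF : (Module.finrank K F).Prime) {w : F} (hw : v (algebraMap F Ω w) = 1)
    (hwK : ∀ a : K, 1 ≤ v (algebraMap F Ω (w - algebraMap K F a)))
    {n : ℕ} (hn : v n = 1) (hwn : v (algebraMap F Ω (w ^ n - 1)) < 1) :
    ∃ η : F, η ^ n = 1 ∧ K⟮η⟯ = ⊤ ∧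
      (∀ σ τ : F →ₐ[K] Ω, σ ≠ τ → v (σ η - τ η) = 1) ∧
      ∀ σ τ : F →ₐ[K] Ω, σ ≠ τ → v (σ w - τ w) = 1 := by
  obtain ⟨η, hηn, hη⟩ := hv.exists_pow_eq hn hw hwn
  have htop : K⟮η⟯ = ⊤ := by
    apply adjoin_eq_top_of_notMem_range hF
    rintro ⟨a, rfl⟩
    refine (hwK a).not_gt ?_
    rwa [map_sub, v.map_sub_swap, ← map_sub]
  have hη1 : ∀ σ : F →ₐ[K] Ω, v (σ η) = 1 := fun σ => by
    have hn0 : n ≠ 0 := by rintro rfl; simp at hn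
    rw [← pow_eq_one_iff_of_nonneg zero_le hn0, ← map_pow, ← map_pow, hηn, map_one, map_one]
  have hd : ∀ σ τ : F →ₐ[K] Ω, σ ≠ τ → v (σ η - τ η) = 1 := by
    intro σ τ hστ
    refine le_antisymm (v.map_sub_le (hη1 σ).le (hη1 τ).le) (not_lt.1 fun hlt => hστ ?_)
    apply algHom_injective_of_adjoin_eq_top htop
    refine eq_of_pow_eq_pow hn (ne_zero_of_val_eq_one (hη1 τ)) ?_ (by rwa [hη1 τ])
    rw [← map_pow, ← map_pow, hηn, map_one, map_one]
  refine ⟨η, hηn, htop, hd, fun σ τ hστ => ?_⟩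
  rw [← hd σ τ hστ]
  apply v.map_eq_of_sub_lt
  -- Since `η` and `w` are congruent, so are their conjugates; the differences therefore agree
  -- modulo the maximal ideal.
  have : σ w - τ w - (σ η - τ η) = τ (η - w) - σ (η - w) := by simp only [map_sub]; ring
  rw [this, hd σ τ hστ]
  exact v.map_sub_lt (by rwa [hv.algHom_apply]) (by rwa [hv.algHom_apply])

section Ramified

variable {x : F} {s : ℤ}

omit [FiniteDimensional K F] [CharZero K] [IsAlgClosed Ω] [Algebra.IsAlgebraic K Ω] in
lemma notMem_range_of_val (hK : HasValues K v c) (hc0 : 0 < c) (hc1 : c < 1)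
    (hF : (Module.finrank K F).Prime)
    (hx : v (algebraMap F Ω x) ^ Module.finrank K F = c ^ s)
    (hs : ¬ (Module.finrank K F : ℤ) ∣ s) : x ∉ Set.range (algebraMap K F) := by
  rintro ⟨a, rfl⟩
  rw [← IsScalarTower.algebraMap_apply] at hx
  exact hs (hK.dvd_of_pow_eq hc0 hc1 hF.ne_zero hx)

omit [CharZero K] [IsAlgClosed Ω] [Algebra.IsAlgebraic K Ω] in
/-- If `F` contains an element whose value generates the values of `K` only after raising to the
power `[F : K]`, then the residue field does not grow. -/
lemma HasValues.exists_residue (hK : HasValues K v c) (hc0 : 0 < c) (hc1 : c < 1)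
    (hF : (Module.finrank K F).Prime)
    (hx : v (algebraMap F Ω x) ^ Module.finrank K F = c ^ s)
    (hs : ¬ (Module.finrank K F : ℤ) ∣ s) {y : F} (hy : v (algebraMap F Ω y) = 1) :
    ∃ a : K, v (algebraMap F Ω (y - algebraMap K F a)) < 1 := by
  classical
  set q := Module.finrank K F with hq
  have hqi : Prime (q : ℤ) := Nat.prime_iff_prime_int.1 hF
  obtain ⟨pb, hgen, hdim⟩ := exists_powerBasis
    (adjoin_eq_top_of_notMem_range hF (notMem_range_of_val hK hc0 hc1 hF hx hs))
  -- The terms of the expansion of `y` in powers of `x`. The `i`-th one, raised to the power `q`,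
  -- has exponent `≡ s i` mod `q`; as `q ∤ s` and `0 ≤ i < q`, nonzero terms have distinct values
  -- and cannot cancel.
  let f : Fin pb.dim → Ω := fun i =>
    algebraMap F Ω (algebraMap K F (pb.basis.repr y i) * x ^ (i : ℕ))
  have hsum : ∑ i, f i = algebraMap F Ω y := by
    rw [← map_sum]
    congr 1
    conv_rhs => rw [← pb.basis.sum_repr y]
    simp [pb.basis_eq_pow, hgen, Algebra.smul_def]
  have hval : ∀ i, f i ≠ 0 → ∃ n : ℤ, v (f i) ^ q = c ^ (q * n + s * i) := by
    intro i hi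
    have h0 : pb.basis.repr y i ≠ 0 := fun h => hi (by simp [f, h])
    obtain ⟨n, hn⟩ := hK _ h0
    refine ⟨n, ?_⟩
    simp only [f]
    rw [map_mul, ← IsScalarTower.algebraMap_apply, map_mul, hn, map_pow, map_pow, mul_pow,
      ← pow_mul, mul_comm (i : ℕ), pow_mul, hx, zpow_add₀ hc0.ne', mul_comm (q : ℤ), zpow_mul,
      zpow_mul, zpow_natCast, zpow_natCast]
  have hdist : ∀ i ∈ univ, ∀ j ∈ univ, f i ≠ 0 → v (f i) = v (f j) → i = j := by
    intro i _ j _ hi hij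
    have hj : f j ≠ 0 := by rw [← v.ne_zero_iff, ← hij]; exact v.ne_zero_iff.2 hi
    obtain ⟨n, hn⟩ := hval i hi
    obtain ⟨m, hm⟩ := hval j hj
    rw [hij, hm] at hn
    have h1 := zpow_right_injective₀ hc0 hc1.ne hn
    have h2 : (q : ℤ) ∣ s * ((i : ℤ) - j) := ⟨m - n, by linarith⟩
    have h3 := (hqi.dvd_or_dvd h2).resolve_left hs
    have hi' := i.2
    have hj' := j.2
    have := Int.eq_zero_of_abs_lt_dvd h3 (by rw [abs_lt]; omega)
    ext
    omega
  have hle : ∀ i, v (f i) ≤ 1 := fun i => by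
    rw [← hy, ← hsum]; exact val_le_val_sum hdist (Finset.mem_univ i)
  -- A term of value `1` has exponent `0`, which forces `q ∣ i`. So `y` is congruent to its constant
  -- coefficient.
  have hlt : ∀ i : Fin pb.dim, (i : ℕ) ≠ 0 → v (f i) < 1 := by
    intro i hi
    refine lt_of_le_of_ne (hle i) fun h1 => ?_
    have h0 : f i ≠ 0 := ne_zero_of_val_eq_one h1
    obtain ⟨n, hn⟩ := hval i h0
    rw [h1, one_pow, ← zpow_zero c] at hn
    have h1 := zpow_right_injective₀ hc0 hc1.ne hn
    have h2 : (q : ℤ) ∣ s * i := ⟨-n, by linarith⟩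
    have h3 := (hqi.dvd_or_dvd h2).resolve_left hs
    have hi' := i.2
    have := Nat.le_of_dvd (Nat.pos_of_ne_zero hi) (Int.natCast_dvd_natCast.1 h3)
    omega
  let i₀ : Fin pb.dim := ⟨0, hdim ▸ hF.pos⟩
  refine ⟨pb.basis.repr y i₀, ?_⟩
  have : algebraMap F Ω (y - algebraMap K F (pb.basis.repr y i₀)) = ∑ i ∈ univ.erase i₀, f i := by
    rw [map_sub, ← hsum, ← Finset.add_sum_erase univ f (Finset.mem_univ i₀)]
    simp [f, i₀]
  rw [this]
  refine v.map_sum_lt one_ne_zero fun i hi => hlt i fun h => ?_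
  exact Finset.ne_of_mem_erase hi (Fin.ext h)

/-- A ramified extension of prime degree prime to the residue characteristic is generated by a
radical that approximates a given element of minimal nontrivial value. -/
lemma HasValues.exists_radical (hK : HasValues K v c) (hv : IsConjInvariant v K) (hc0 : 0 < c)
    (hc1 : c < 1) (hF : (Module.finrank K F).Prime) (hq : v (Module.finrank K F : ℕ) = 1)
    (hx : v (algebraMap F Ω x) ^ Module.finrank K F = c ^ s)
    (hs : ¬ (Module.finrank K F : ℤ) ∣ s) {π : K} (hπ : v (algebraMap K Ω π) = c) :
    ∃ (β : F) (b : K), v (algebraMap K Ω b) = 1 ∧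
      β ^ Module.finrank K F = algebraMap K F (π ^ s * b) ∧
      v (algebraMap F Ω (x - β)) < v (algebraMap F Ω β) ∧
      v (algebraMap F Ω β) = v (algebraMap F Ω x) := by
  set q := Module.finrank K F
  have hπ0 : algebraMap K F π ≠ 0 := by
    intro h
    rw [map_eq_zero] at h
    simp [h] at hπ
    exact hc0.ne hπ
  have hx0 : x ≠ 0 := by
    rintro rfl
    rw [map_zero, map_zero, zero_pow hF.ne_zero] at hx
    exact (zpow_pos hc0 s).ne hx
  have hy : v (algebraMap F Ω (x ^ q / algebraMap K F π ^ s)) = 1 := by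
    rw [map_div₀, map_div₀, map_pow, map_pow, hx, map_zpow₀, map_zpow₀,
      ← IsScalarTower.algebraMap_apply, hπ, div_self (zpow_pos hc0 s).ne']
  obtain ⟨b, hb⟩ := hK.exists_residue hc0 hc1 hF hx hs hy
  have hvb : v (algebraMap K Ω b) = 1 := by
    rw [← hy, IsScalarTower.algebraMap_apply K F Ω]
    apply v.map_eq_of_sub_lt
    rwa [hy, v.map_sub_swap, ← map_sub]
  have hb0 : algebraMap K F b ≠ 0 := by
    intro h
    rw [map_eq_zero] at h
    simp [h] at hvb
  -- After division by `b` the unit `x^q / π^s` becomes a principal unit, hence a `q`-th power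
  -- `z^q`; the radical is `β = x / z`.
  obtain ⟨z, hz, hz1⟩ := hv.exists_pow_eq_of_mem (F := F) hq
    (y := x ^ q / algebraMap K F π ^ s / algebraMap K F b) (by
      rw [map_div₀, div_mem_principalUnits_iff (by simpa using hb0), ← map_sub,
        ← IsScalarTower.algebraMap_apply, hvb]
      exact hb)
  have hvz := val_eq_one_of_mem hz1
  have hz0 : z ≠ 0 := by rintro rfl; simp at hvz
  have hvβ : v (algebraMap F Ω (x / z)) = v (algebraMap F Ω x) := by
    rw [map_div₀, map_div₀, hvz, div_one]
  refine ⟨x / z, b, hvb, ?_, ?_, hvβ⟩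
  · rw [div_pow, hz, map_mul, map_zpow₀]
    have := zpow_ne_zero s hπ0
    field_simp
  · rw [hvβ]
    have : x - x / z = x * (1 - z⁻¹) := by field_simp
    have h1 := inv_mem_principalUnits hz1
    rw [mem_principalUnits, v.map_sub_swap] at h1
    rw [this, map_mul, map_mul, map_sub, map_one, map_inv₀]
    refine mul_lt_of_lt_one_right (pos_iff_ne_zero.2 (v.ne_zero_iff.2 ?_)) h1
    simpa using hx0

omit [CharZero K] in
lemma minpoly_of_pow_eq {β : F} (hβ : K⟮β⟯ = ⊤) {B : K}
    (h : β ^ Module.finrank K F = algebraMap K F B) :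
    minpoly K β = X ^ Module.finrank K F - C B := by
  have hint : IsIntegral K β := Algebra.IsIntegral.isIntegral β
  have hm : (X ^ Module.finrank K F - C B).Monic :=
    monic_X_pow_sub_C B Module.finrank_pos.ne'
  symm
  refine eq_of_monic_of_dvd_of_natDegree_le (minpoly.monic hint) hm
    (minpoly.dvd K β (by simp [h])) ?_
  rw [natDegree_X_pow_sub_C, (Field.primitive_element_iff_minpoly_natDegree_eq K β).1 hβ]

omit [IsScalarTower K F Ω] [Algebra.IsAlgebraic K Ω] [Algebra F Ω] in
-- The derivative of `X^q - B` at `σ β` is `q (σ β)^(q-1)`; the product over all `σ` is `q^q` times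
-- the norm of `β` to the power `q - 1`, and the norm is read off the constant coefficient.
lemma diffProd_of_pow_eq {β : F} (hβ : K⟮β⟯ = ⊤) {B : K}
    (h : β ^ Module.finrank K F = algebraMap K F B) :
    diffProd K Ω β = algebraMap K Ω ((Module.finrank K F : K) ^ Module.finrank K F *
      ((-1) ^ Module.finrank K F * (-B)) ^ (Module.finrank K F - 1)) := by
  classical
  have hmin := minpoly_of_pow_eq hβ h
  have hnorm : Algebra.norm K β = (-1) ^ Module.finrank K F * (-B) := by
    obtain ⟨pb, hgen, hdim⟩ := exists_powerBasis hβ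
    have := Algebra.PowerBasis.norm_gen_eq_coeff_zero_minpoly pb
    rw [hgen, hdim, hmin] at this
    simpa [Module.finrank_pos.ne', Module.finrank_pos.ne] using this
  have : ∀ σ : F →ₐ[K] Ω, ∏ τ ∈ univ.erase σ, (σ β - τ β) =
      (Module.finrank K F : Ω) * σ β ^ (Module.finrank K F - 1) := by
    intro σ
    rw [← aeval_derivative_minpoly hβ σ, hmin, derivative_sub, derivative_X_pow, derivative_C]
    simp
  rw [diffProd, Finset.prod_congr rfl fun σ _ => this σ, Finset.prod_mul_distrib,
    Finset.prod_const, Finset.card_univ, AlgHom.card K F Ω, Finset.prod_pow,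
    ← Algebra.norm_eq_prod_embeddings, hnorm]
  simp

omit [CharZero K] in
-- The signs in the discriminant of `X^q - B` are harmless modulo `q`-th powers: for odd `q` a sign
-- is its own `q`-th power, and for `q = 2` the two signs cancel.
lemma exists_sign_pow_eq {q : ℕ} (hq : q.Prime) :
    ∃ ε : K, ε ^ 2 = 1 ∧
      (-1) ^ (q * (q - 1) / 2) * ((-1) ^ q * (-1)) ^ (q - 1) = ε ^ q := by
  rcases hq.eq_two_or_odd' with rfl | hodd
  · exact ⟨1, by simp, by norm_num⟩
  · refine ⟨(-1) ^ (q * (q - 1) / 2), by rw [← pow_mul, mul_comm, pow_mul]; simp, ?_⟩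
    rw [hodd.neg_one_pow, neg_mul_neg, one_mul, one_pow, mul_one, ← pow_mul]
    rcases Nat.even_or_odd (q * (q - 1) / 2) with h | h
    · rw [h.neg_one_pow, (h.mul_right q).neg_one_pow]
    · rw [h.neg_one_pow, (h.mul hodd).neg_one_pow]

/-- The discriminant of a ramified extension of prime degree, up to powers of the uniformizer,
`q`-th powers and principal units. -/
lemma HasValues.exists_radical_discr (hK : HasValues K v c) (hv : IsConjInvariant v K)
    (hc0 : 0 < c) (hc1 : c < 1) (hF : (Module.finrank K F).Prime)
    (hq : v (Module.finrank K F : ℕ) = 1)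
    (hx : v (algebraMap F Ω x) ^ Module.finrank K F = c ^ s)
    (hs : ¬ (Module.finrank K F : ℤ) ∣ s) {π : K} (hπ : v (algebraMap K Ω π) = c) {D : K}
    (hD : algebraMap K Ω D =
      (-1) ^ (Module.finrank K F * (Module.finrank K F - 1) / 2) * diffProd K Ω x) :
    ∃ (β : F) (b e u : K), v (algebraMap K Ω b) = 1 ∧ v (algebraMap K Ω e) = 1 ∧
      v (algebraMap K Ω u) = 1 ∧
      β ^ Module.finrank K F = algebraMap K F (π ^ s * b) ∧
      D = π ^ (s * ((Module.finrank K F : ℤ) - 1)) * u ∧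
      algebraMap K Ω (u * b / e ^ Module.finrank K F) ∈ principalUnits v := by
  obtain ⟨β, b, hb, hβ, hxβ, hvβ⟩ := hK.exists_radical hv hc0 hc1 hF hq hx hs hπ
  set q := Module.finrank K F with hqdef
  have hπ0 : π ≠ 0 := by rintro rfl; simp at hπ; exact hc0.ne hπ
  have hb0 : b ≠ 0 := by rintro rfl; simp at hb
  have hβtop : K⟮β⟯ = ⊤ := adjoin_eq_top_of_notMem_range hF
    (notMem_range_of_val hK hc0 hc1 hF (by rw [hvβ, hx]) hs)
  have hvβ0 : v (algebraMap F Ω β) ≠ 0 := (zero_le.trans_lt hxβ).ne'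
  -- Distinct conjugates of `β` are distinct `q`-th roots of one element of `K`; as `q` is a unit,
  -- they cannot be closer than their own size.
  have hdiff : ∀ σ τ : F →ₐ[K] Ω, σ ≠ τ → v (σ β - τ β) = v (algebraMap F Ω β) := by
    intro σ τ hστ
    refine le_antisymm (v.map_sub_le (hv.algHom_apply σ β).le (hv.algHom_apply τ β).le)
      (not_lt.1 fun hlt => hστ ?_)
    apply algHom_injective_of_adjoin_eq_top hβtop
    refine eq_of_pow_eq_pow hq ?_ ?_ (by rwa [hv.algHom_apply])
    · rw [← v.ne_zero_iff, hv.algHom_apply]; exact hvβ0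
    · rw [← map_pow, ← map_pow, hβ, AlgHom.commutes, AlgHom.commutes]
  have hR : diffProd K Ω x / diffProd K Ω β ∈ principalUnits v := by
    refine diffProd_div_mem fun σ τ hστ => ?_
    have h1 := hdiff σ τ hστ
    rw [div_mem_principalUnits_iff (by rw [← v.ne_zero_iff, h1]; exact hvβ0), h1]
    have : σ x - τ x - (σ β - τ β) = σ (x - β) - τ (x - β) := by simp only [map_sub]; ring
    rw [this]
    exact v.map_sub_lt (by rwa [hv.algHom_apply]) (by rwa [hv.algHom_apply])
  obtain ⟨ε, hε, hsign⟩ := exists_sign_pow_eq (K := K) hF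
  have hvε : v (algebraMap K Ω ε) = 1 := by
    rw [← pow_eq_one_iff_of_nonneg zero_le two_ne_zero, ← map_pow, ← map_pow, hε, map_one, map_one]
  have hvq : v (algebraMap K Ω (q : K)) = 1 := by rw [map_natCast]; exact hq
  have hq0 : (q : K) ≠ 0 := Nat.cast_ne_zero.2 hF.ne_zero
  have hε0 : ε ≠ 0 := by rintro rfl; simp at hvε
  have hπs : π ^ s ≠ 0 := zpow_ne_zero s hπ0
  have hqpred : ((q : ℤ) - 1) = ((q - 1 : ℕ) : ℤ) := by rw [Nat.cast_sub hF.one_le]; simp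
  have hπq : π ^ (s * ((q : ℤ) - 1)) = (π ^ s) ^ (q - 1) := by
    rw [zpow_mul, hqpred, zpow_natCast]
  have hprod : ∀ y : K, y ^ (q - 1) * y = y ^ q := fun y => by
    rw [← pow_succ, Nat.sub_add_cancel hF.one_le]
  -- `P` is the discriminant of `X^q - π^s b`. One more factor `π^s b` makes it a `q`-th power.
  set P : K := (-1) ^ (q * (q - 1) / 2) * ((q : K) ^ q * ((-1) ^ q * (-(π ^ s * b))) ^ (q - 1))
    with hP
  have hPb : P * (π ^ s * b) = (ε * q * (π ^ s * b)) ^ q := by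
    rw [mul_pow, mul_pow, ← hsign, hP, ← hprod (π ^ s * b)]
    have : (-1 : K) ^ q * (-(π ^ s * b)) = ((-1) ^ q * (-1)) * (π ^ s * b) := by ring
    rw [this, mul_pow _ (π ^ s * b)]
    ring
  have hP0 : P ≠ 0 := by
    have : P * (π ^ s * b) ≠ 0 := by
      rw [hPb]
      exact pow_ne_zero _ (mul_ne_zero (mul_ne_zero hε0 hq0) (mul_ne_zero hπs hb0))
    exact left_ne_zero_of_mul this
  have hDP : algebraMap K Ω (D / P) = diffProd K Ω x / diffProd K Ω β := by
    rw [diffProd_of_pow_eq hβtop hβ, map_div₀, hD, hP, map_mul (algebraMap K Ω)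
      ((-1) ^ (q * (q - 1) / 2))]
    simp only [map_pow _ (-1 : K), map_neg, map_one]
    rw [mul_div_mul_left]
    exact pow_ne_zero _ (by simp)
  -- With `u = D / π^(s(q-1))` and `e = ε q b`, the quotient `u b / e^q` is exactly `D / P`, which
  -- is a principal unit by `hR`.
  have hkey : D / π ^ (s * ((q : ℤ) - 1)) * b / (ε * q * b) ^ q = D / P := by
    rw [hπq]
    have h1 : (ε * q * (π ^ s * b)) ^ q = (ε * q * b) ^ q * ((π ^ s) ^ (q - 1) * π ^ s) := by
      rw [hprod, ← mul_pow]; ring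
    rw [h1] at hPb
    have h2 : (ε * q * b) ^ q ≠ 0 := pow_ne_zero _ (mul_ne_zero (mul_ne_zero hε0 hq0) hb0)
    have h3 : (π ^ s) ^ (q - 1) ≠ 0 := pow_ne_zero _ hπs
    rw [div_mul_eq_mul_div, div_div, div_eq_div_iff (mul_ne_zero h3 h2) hP0]
    have : P * b = (ε * q * b) ^ q * (π ^ s) ^ (q - 1) :=
      mul_right_cancel₀ hπs (by linear_combination hPb)
    linear_combination D * this
  have hmem : algebraMap K Ω (D / π ^ (s * ((q : ℤ) - 1)) * b / (ε * q * b) ^ q) ∈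
      principalUnits v := by rw [hkey, hDP]; exact hR
  have hve : v (algebraMap K Ω (ε * q * b)) = 1 := by
    rw [map_mul, map_mul, map_mul, map_mul, hvε, hvq, hb]; simp
  refine ⟨β, b, ε * q * b, D / π ^ (s * ((q : ℤ) - 1)), hb, hve, ?_, hβ, ?_, hmem⟩
  · have := val_eq_one_of_mem hmem
    rwa [map_div₀, map_div₀, map_pow, map_pow, hve, one_pow, div_one, map_mul, map_mul, hb,
      mul_one] at this
  · rw [mul_div_cancel₀]; exact zpow_ne_zero _ hπ0

omit [FiniteDimensional K F] in
/-- Adjusting a radical generator by units that are `q`-th powers modulo the maximal ideal. -/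
lemma HasValues.exists_radical_eq (hK : HasValues K v c) (hv : IsConjInvariant v K)
    (hc0 : 0 < c) (hc1 : c < 1) (hF : (Module.finrank K F).Prime)
    (hq : v (Module.finrank K F : ℕ) = 1) {π : K} (hπ : v (algebraMap K Ω π) = c)
    {β : F} {b e u : K} (hb : v (algebraMap K Ω b) = 1) (he : v (algebraMap K Ω e) = 1)
    (hβ : β ^ Module.finrank K F = algebraMap K F (π ^ s * b))
    (hu : algebraMap K Ω (u * b / e ^ Module.finrank K F) ∈ principalUnits v)
    {ℓ : ℤ} (hℓ : s * ℓ ≡ 1 [ZMOD Module.finrank K F]) {g d : K} (hg : v (algebraMap K Ω g) = 1)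
    (hd : v (algebraMap K Ω d) = 1)
    (h : v (algebraMap K Ω (g * u ^ ℓ - d ^ Module.finrank K F)) < 1) :
    ∃ α : F, K⟮α⟯ = ⊤ ∧ α ^ Module.finrank K F = algebraMap K F (g * π) := by
  set q := Module.finrank K F with hqdef
  have hπ0 : π ≠ 0 := by rintro rfl; simp at hπ; exact hc0.ne hπ
  have hb0 : b ≠ 0 := by rintro rfl; simp at hb
  have he0 : e ≠ 0 := by rintro rfl; simp at he
  have hg0 : g ≠ 0 := by rintro rfl; simp at hg
  have hd0 : d ≠ 0 := by rintro rfl; simp at hd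
  have hu0 : u ≠ 0 := by
    rintro rfl
    have := val_eq_one_of_mem hu
    simp at this
  obtain ⟨t, ht⟩ := hℓ.symm.dvd
  have h1 : algebraMap K Ω (g * u ^ ℓ / d ^ q) ∈ principalUnits v := by
    rw [map_div₀, div_mem_principalUnits_iff (by simpa using pow_ne_zero q hd0), ← map_sub,
      map_pow, map_pow, hd, one_pow]
    exact h
  have h2 : algebraMap K Ω ((u * b / e ^ q) ^ ℓ / (g * u ^ ℓ / d ^ q)) ∈ principalUnits v := by
    rw [div_eq_mul_inv, map_mul, map_zpow₀, map_inv₀]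
    exact mul_mem (zpow_mem_principalUnits hu ℓ) (inv_mem_principalUnits h1)
  obtain ⟨z, hz, hz1⟩ := hv.exists_pow_eq_of_mem (F := K) hq h2
  have hz0 : z ≠ 0 := by
    rintro rfl
    have := val_eq_one_of_mem hz1
    simp at this
  -- Both `(u b / e^q)^ℓ` and `g u^ℓ / d^q` are principal units; in their quotient `u` cancels, and
  -- that quotient is `z^q`.
  have hbl : b ^ ℓ = g * (e ^ ℓ * z / d) ^ q := by
    rw [div_pow, mul_pow, hz, div_zpow, mul_zpow, ← zpow_natCast (e ^ ℓ), ← zpow_natCast e,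
      ← zpow_mul, ← zpow_mul, mul_comm (q : ℤ)]
    have := zpow_ne_zero ℓ hu0
    have := zpow_ne_zero (ℓ * q) he0
    field_simp
  -- With `sℓ = 1 + tq`, the `q`-th power of `β^ℓ` is `π^(1+tq) b^ℓ = g π a^q`.
  set a : K := π ^ t * (e ^ ℓ * z / d) with ha
  have ha0 : a ≠ 0 := mul_ne_zero (zpow_ne_zero _ hπ0)
    (div_ne_zero (mul_ne_zero (zpow_ne_zero _ he0) hz0) hd0)
  have hpow : (β ^ ℓ / algebraMap K F a) ^ q = algebraMap K F (g * π) := by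
    rw [div_pow, ← zpow_natCast (β ^ ℓ), ← zpow_mul, mul_comm ℓ, zpow_mul, zpow_natCast, hβ,
      ← map_zpow₀, ← map_pow, ← map_div₀]
    congr 1
    rw [mul_zpow, hbl, ha, mul_pow, ← zpow_mul, show s * ℓ = 1 + t * q by linarith,
      zpow_add₀ hπ0, zpow_one, zpow_mul, zpow_natCast]
    have := zpow_ne_zero t hπ0
    have := zpow_ne_zero ℓ he0
    field_simp
  refine ⟨_, adjoin_eq_top_of_notMem_range hF (notMem_range_of_val hK hc0 hc1 hF (s := 1) ?_ ?_),
    hpow⟩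
  · rw [← map_pow, ← map_pow, ← hqdef, hpow, ← IsScalarTower.algebraMap_apply, map_mul, map_mul,
      hg, hπ, one_mul, zpow_one]
  · intro hdvd
    exact hF.one_lt.ne' (by exact_mod_cast Int.eq_one_of_dvd_one (by positivity) hdvd)

end Ramified

end PrimeDegree

/-! ### The spectral norm, integrality and unramifiedness over `ℚ_p` -/

section Padic

variable (p : ℕ) [Fact p.Prime] (Ω : Type*) [Field Ω] [Algebra ℚ_[p] Ω]
  [Algebra.IsAlgebraic ℚ_[p] Ω]

/-- The extension of the `p`-adic absolute value to an algebraic extension of `ℚ_p`, as a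
valuation. -/
noncomputable def spectralVal : Valuation Ω ℝ≥0 where
  toFun x := ⟨spectralNorm ℚ_[p] Ω x, spectralNorm_nonneg x⟩
  map_zero' := by ext; exact spectralNorm_zero
  map_one' := by ext; exact spectralNorm_one
  map_mul' x y := by ext; exact spectralAlgNorm_mul x y
  map_add_le_max' x y := by
    exact (le_max_iff.1 (isNonarchimedean_spectralNorm x y)).elim
      (fun h => le_max_of_le_left h) fun h => le_max_of_le_right h

lemma coe_spectralVal (x : Ω) : (spectralVal p Ω x : ℝ) = spectralNorm ℚ_[p] Ω x := rfl

variable {p Ω}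

lemma spectralVal_algebraMap (x : ℚ_[p]) : spectralVal p Ω (algebraMap ℚ_[p] Ω x) = ‖x‖₊ := by
  ext; rw [coe_spectralVal, spectralNorm_extends]; rfl

lemma spectralVal_natCast_eq_one_iff {n : ℕ} : spectralVal p Ω n = 1 ↔ p.Coprime n := by
  rw [← map_natCast (algebraMap ℚ_[p] Ω), spectralVal_algebraMap, ← Padic.norm_natCast_eq_one_iff,
    ← NNReal.coe_inj]
  rfl

lemma spectralVal_p_pos : 0 < spectralVal p Ω (p : Ω) := by
  rw [pos_iff_ne_zero, Valuation.ne_zero_iff, ← map_natCast (algebraMap ℚ_[p] Ω), _root_.map_ne_zero]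
  exact_mod_cast (Fact.out : p.Prime).ne_zero

lemma spectralVal_p_lt_one : spectralVal p Ω (p : Ω) < 1 := by
  rw [← map_natCast (algebraMap ℚ_[p] Ω), spectralVal_algebraMap, ← NNReal.coe_lt_coe]
  exact Padic.norm_p_lt_one

/-- The spectral norm depends only on the minimal polynomial over `ℚ_p`, which elements conjugate
over `K` share. -/
lemma isConjInvariant_spectralVal (K : Type*) [Field K] [Algebra ℚ_[p] K] [Algebra K Ω]
    [IsScalarTower ℚ_[p] K Ω] : IsConjInvariant (spectralVal p Ω) K := by
  intro x y h
  have hx : IsIntegral ℚ_[p] x := Algebra.IsIntegral.isIntegral x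
  have : aeval y (minpoly ℚ_[p] x) = 0 := by
    have h1 := minpoly.dvd_map_of_isScalarTower ℚ_[p] K x
    rw [show minpoly K x = minpoly K y from h] at h1
    have := aeval_eq_zero_of_dvd_aeval_eq_zero h1 (minpoly.aeval K y)
    rwa [aeval_map_algebraMap] at this
  have he := minpoly.eq_of_irreducible_of_monic (minpoly.irreducible hx) this (minpoly.monic hx)
  ext
  rw [coe_spectralVal, coe_spectralVal, spectralNorm, spectralNorm, he]

/-- Both sides say that the minimal polynomial over `ℚ_p` has coefficients in `ℤ_p`. -/
lemma isIntegral_iff_spectralVal_le_one [Algebra ℤ_[p] Ω] [IsScalarTower ℤ_[p] ℚ_[p] Ω] {x : Ω} :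
    IsIntegral ℤ_[p] x ↔ spectralVal p Ω x ≤ 1 := by
  have hx : IsIntegral ℚ_[p] x := Algebra.IsIntegral.isIntegral x
  rw [← NNReal.coe_le_coe, coe_spectralVal, NNReal.coe_one, spectralNorm,
    spectralValue_le_one_iff (minpoly.monic hx)]
  constructor
  · intro h n
    rw [minpoly.isIntegrallyClosed_eq_field_fractions' ℚ_[p] h, coeff_map]
    exact PadicInt.norm_le_one _
  · intro h
    have hl : minpoly ℚ_[p] x ∈ lifts (algebraMap ℤ_[p] ℚ_[p]) := by
      rw [lifts_iff_coeff_lifts]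
      exact fun n => ⟨⟨_, h n⟩, rfl⟩
    obtain ⟨g, hg, -, hm⟩ := lifts_and_degree_eq_and_monic hl (minpoly.monic hx)
    refine ⟨g, hm, ?_⟩
    rw [← aeval_def, ← aeval_map_algebraMap ℚ_[p], hg, minpoly.aeval]

variable {E : Type*} [Field E] [Algebra ℚ_[p] E] [Algebra ℤ_[p] E] [IsScalarTower ℤ_[p] ℚ_[p] E]
  [Algebra E Ω] [IsScalarTower ℚ_[p] E Ω]

lemma isIntegral_iff_le_one {x : E} :
    IsIntegral ℤ_[p] x ↔ spectralVal p Ω (algebraMap E Ω x) ≤ 1 := by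
  let : Algebra ℤ_[p] Ω := ((algebraMap ℚ_[p] Ω).comp (algebraMap ℤ_[p] ℚ_[p])).toAlgebra
  have : IsScalarTower ℤ_[p] ℚ_[p] Ω := .of_algebraMap_eq fun _ => rfl
  have : IsScalarTower ℤ_[p] E Ω := .of_algebraMap_eq fun a => by
    rw [IsScalarTower.algebraMap_apply ℤ_[p] ℚ_[p] Ω, IsScalarTower.algebraMap_apply ℚ_[p] E Ω,
      IsScalarTower.algebraMap_apply ℤ_[p] ℚ_[p] E]
  rw [← isIntegral_iff_spectralVal_le_one, isIntegral_algebraMap_iff (algebraMap E Ω).injective]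

lemma val_le_one (x : ringOfIntegers p E) : spectralVal p Ω (algebraMap E Ω x) ≤ 1 :=
  isIntegral_iff_le_one.1 x.2

omit [Algebra ℚ_[p] E] [Algebra ℤ_[p] E] [IsScalarTower ℤ_[p] ℚ_[p] E]
  [IsScalarTower ℚ_[p] E Ω] in
lemma val_natCast_p : spectralVal p Ω (algebraMap E Ω (p : E)) = spectralVal p Ω (p : Ω) := by
  rw [map_natCast]

omit [Algebra ℤ_[p] E] [IsScalarTower ℤ_[p] ℚ_[p] E] in
lemma natCast_p_ne_zero : (p : E) ≠ 0 := by
  rw [← map_natCast (algebraMap ℚ_[p] E), _root_.map_ne_zero]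
  exact_mod_cast (Fact.out : p.Prime).ne_zero

lemma exists_mul_p_iff {x : E} :
    (∃ a : ringOfIntegers p E, x = (p : E) * a) ↔
      spectralVal p Ω (algebraMap E Ω x) ≤ spectralVal p Ω (p : Ω) := by
  constructor
  · rintro ⟨a, rfl⟩
    rw [map_mul, map_mul, val_natCast_p]
    exact mul_le_of_le_one_right zero_le (val_le_one a)
  · intro h
    refine ⟨⟨x / p, ?_⟩, (mul_div_cancel₀ x natCast_p_ne_zero).symm⟩
    change IsIntegral _ _
    rw [isIntegral_iff_le_one (Ω := Ω), map_div₀, map_div₀, val_natCast_p]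
    exact div_le_one_of_le₀ h zero_le

omit [Algebra ℚ_[p] E] [Algebra ℤ_[p] E] [IsScalarTower ℤ_[p] ℚ_[p] E]
  [IsScalarTower ℚ_[p] E Ω] in
/-- If every element of value less than `1` is divisible by `p`, then `p` generates the value
group. -/
lemma hasValues_of_le (h : ∀ x : E, spectralVal p Ω (algebraMap E Ω x) < 1 →
    spectralVal p Ω (algebraMap E Ω x) ≤ spectralVal p Ω (p : Ω)) :
    HasValues E (spectralVal p Ω) (spectralVal p Ω (p : Ω)) := by
  intro x hx
  set c := spectralVal p Ω (p : Ω)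
  have hc0 : 0 < c := spectralVal_p_pos
  have hx0 : 0 < spectralVal p Ω (algebraMap E Ω x) :=
    pos_iff_ne_zero.2 (by simpa [Valuation.ne_zero_iff] using hx)
  -- Brackets `|x|` in `c^(-n) < |x| ≤ c^(-(n+1))`. If the upper bound were strict, `x / p^(-(n+1))`
  -- would have value below `1`, hence at most `c`, against the lower bound.
  obtain ⟨n, hn1, hn2⟩ := exists_mem_Ioc_zpow hx0 ((one_lt_inv₀ hc0).2 spectralVal_p_lt_one)
  refine ⟨-(n + 1), ?_⟩
  rw [inv_zpow'] at hn1 hn2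
  refine le_antisymm hn2 (not_lt.1 fun hlt => ?_)
  have hval : spectralVal p Ω (algebraMap E Ω (x / (p : E) ^ (-(n + 1)))) =
      spectralVal p Ω (algebraMap E Ω x) / c ^ (-(n + 1)) := by
    rw [map_div₀, map_div₀, map_zpow₀, map_zpow₀, val_natCast_p]
  have h1 := h (x / (p : E) ^ (-(n + 1)))
  rw [hval, div_lt_one₀ (zpow_pos hc0 _), div_le_iff₀ (zpow_pos hc0 _), ← zpow_one_add₀ hc0.ne']
    at h1
  refine (h1 hlt).not_gt ?_
  convert hn1 using 2
  ring

omit [Algebra ℚ_[p] E] [Algebra ℤ_[p] E] [IsScalarTower ℤ_[p] ℚ_[p] E]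
  [IsScalarTower ℚ_[p] E Ω] in
lemma HasValues.le_of_lt_one (h : HasValues E (spectralVal p Ω) (spectralVal p Ω (p : Ω))) {x : E}
    (hx : spectralVal p Ω (algebraMap E Ω x) < 1) :
    spectralVal p Ω (algebraMap E Ω x) ≤ spectralVal p Ω (p : Ω) := by
  by_cases h0 : x = 0
  · simp [h0]
  obtain ⟨n, hn⟩ := h x h0
  have hc0 : 0 < spectralVal p Ω (p : Ω) := spectralVal_p_pos
  have hc1 : spectralVal p Ω (p : Ω) < 1 := spectralVal_p_lt_one
  rw [hn] at hx ⊢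
  have : 0 < n := by
    by_contra! hle
    exact hx.not_ge (one_le_zpow_of_nonpos₀ hc0 hc1.le hle)
  calc _ ≤ spectralVal p Ω (p : Ω) ^ (1 : ℤ) := zpow_le_zpow_right_of_le_one₀ hc0 hc1.le this
    _ = _ := zpow_one _

/-- The value group of an unramified extension of `ℚ_p` is generated by `p`. -/
lemma hasValues_of_formallyUnramified [FiniteDimensional ℚ_[p] E] (B : Type*) [CommRing B]
    [Algebra B E] [Algebra ℤ_[p] B] [IsScalarTower ℤ_[p] B E] [IsIntegralClosure B ℤ_[p] E]
    [Algebra.FormallyUnramified ℤ_[p] B] :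
    HasValues E (spectralVal p Ω) (spectralVal p Ω (p : Ω)) := by
  refine hasValues_of_le fun x hx => ?_
  -- Unramifiedness makes `pB` a radical ideal. An element of value below `1` has a power of value
  -- at most `c`, so that power, and then the element itself, lies in `pB`.
  have : Module.Finite ℤ_[p] B := IsIntegralClosure.finite ℤ_[p] ℚ_[p] E B
  have hrad := Algebra.FormallyUnramified.isRadical_map_isMaximal (A := ℤ_[p]) B
    (IsLocalRing.maximalIdeal ℤ_[p])
  rw [PadicInt.maximalIdeal_eq_span_p, Ideal.map_span, Set.image_singleton, map_natCast] at hrad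
  have hmem : ∀ b : B, spectralVal p Ω (algebraMap E Ω (algebraMap B E b)) ≤
      spectralVal p Ω (p : Ω) ↔ b ∈ Ideal.span {(p : B)} := by
    intro b
    rw [← exists_mul_p_iff, Ideal.mem_span_singleton]
    constructor
    · rintro ⟨a, ha⟩
      obtain ⟨a', ha'⟩ := (IsIntegralClosure.isIntegral_iff (A := B)).1 a.2
      exact ⟨a', IsIntegralClosure.algebraMap_injective B ℤ_[p] E (by rw [map_mul, ha', ha]; simp)⟩
    · rintro ⟨a, rfl⟩
      exact ⟨⟨algebraMap B E a, (IsIntegralClosure.isIntegral_iff (A := B)).2 ⟨a, rfl⟩⟩, by simp⟩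
  obtain ⟨b, rfl⟩ := (IsIntegralClosure.isIntegral_iff (A := B)).1
    (isIntegral_iff_le_one (Ω := Ω).2 hx.le)
  rw [hmem]
  obtain ⟨n, hn⟩ := exists_pow_lt_of_lt_one (spectralVal_p_pos (p := p) (Ω := Ω)) hx
  refine hrad ⟨n, (hmem _).1 ?_⟩
  rw [map_pow, map_pow, map_pow]
  exact hn.le

end Padic

/-! ### Residue fields and Teichmüller lifts -/

section Residue

attribute [local instance] Ideal.Quotient.field in
lemma natCard_quotient_map_maximalIdeal (R S : Type*) [CommRing R] [IsLocalRing R] [CommRing S]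
    [Algebra R S] [Module.Finite R S] [Module.Free R S] :
    Nat.card (S ⧸ (IsLocalRing.maximalIdeal R).map (algebraMap R S)) =
      Nat.card (R ⧸ IsLocalRing.maximalIdeal R) ^ Module.finrank R S := by
  have : Module.Finite (R ⧸ IsLocalRing.maximalIdeal R)
      (S ⧸ (IsLocalRing.maximalIdeal R).map (algebraMap R S)) :=
    Module.Finite.of_restrictScalars_finite R _ _
  rw [Module.natCard_eq_pow_finrank (K := R ⧸ IsLocalRing.maximalIdeal R),
    IsLocalRing.finrank_quotient_map]

variable (p : ℕ) [Fact p.Prime] (Ω : Type*) [Field Ω] [Algebra ℚ_[p] Ω]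
  [Algebra.IsAlgebraic ℚ_[p] Ω]
  (E : Type*) [Field E] [Algebra ℚ_[p] E] [Algebra ℤ_[p] E] [IsScalarTower ℤ_[p] ℚ_[p] E]
  [Algebra E Ω] [IsScalarTower ℚ_[p] E Ω]

/-- The ideal of the elements of the ring of integers of value less than `1`. -/
noncomputable def residueIdeal : Ideal (ringOfIntegers p E) where
  carrier := {x | spectralVal p Ω (algebraMap E Ω x) < 1}
  zero_mem' := by simp
  add_mem' {a b} ha hb := by
    simp only [Set.mem_ofPred_eq, Subalgebra.coe_add, map_add]
    exact Valuation.map_add_lt _ ha hb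
  smul_mem' a b hb := by
    simp only [Set.mem_ofPred_eq, smul_eq_mul, Subalgebra.coe_mul, map_mul]
    exact mul_lt_one_of_nonneg_of_lt_one_right (val_le_one a) zero_le hb

variable {p Ω E}

lemma mem_residueIdeal {x : ringOfIntegers p E} :
    x ∈ residueIdeal p Ω E ↔ spectralVal p Ω (algebraMap E Ω x) < 1 := Iff.rfl

instance : (residueIdeal p Ω E).IsPrime where
  ne_top' h := by
    have := (Ideal.eq_top_iff_one _).1 h
    simp [mem_residueIdeal] at this
  mem_or_mem' {x y} h := by
    by_contra! hc
    rw [mem_residueIdeal, mem_residueIdeal, not_lt, not_lt] at hc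
    rw [mem_residueIdeal, Subalgebra.coe_mul, map_mul, map_mul] at h
    exact h.not_ge (one_le_mul hc.1 hc.2)

lemma map_maximalIdeal_le :
    (IsLocalRing.maximalIdeal ℤ_[p]).map (algebraMap ℤ_[p] (ringOfIntegers p E)) ≤
      residueIdeal p Ω E := by
  rw [PadicInt.maximalIdeal_eq_span_p, Ideal.map_span, Set.image_singleton, map_natCast,
    Ideal.span_singleton_le_iff_mem, mem_residueIdeal]
  simpa using spectralVal_p_lt_one

variable [FiniteDimensional ℚ_[p] E]

instance : Module.Finite ℤ_[p] (ringOfIntegers p E) := IsIntegralClosure.finite ℤ_[p] ℚ_[p] E _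

instance : Finite (ℤ_[p] ⧸ IsLocalRing.maximalIdeal ℤ_[p]) :=
  Finite.of_equiv (ZMod p) PadicInt.residueField.symm.toEquiv

instance : Finite (ringOfIntegers p E ⧸
    (IsLocalRing.maximalIdeal ℤ_[p]).map (algebraMap ℤ_[p] (ringOfIntegers p E))) :=
  Module.finite_of_finite (ℤ_[p] ⧸ IsLocalRing.maximalIdeal ℤ_[p])

instance : Finite (ringOfIntegers p E ⧸ residueIdeal p Ω E) :=
  Finite.of_surjective _ (Ideal.Quotient.factor_surjective (map_maximalIdeal_le (Ω := Ω)))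

instance : (residueIdeal p Ω E).IsMaximal :=
  Ideal.Quotient.maximal_of_isField _ (Finite.isField_of_domain _)

attribute [local instance] Ideal.Quotient.field

lemma val_card_residue_lt_one :
    spectralVal p Ω (Nat.card (ringOfIntegers p E ⧸ residueIdeal p Ω E) : Ω) < 1 := by
  have h : ((Nat.card (ringOfIntegers p E ⧸ residueIdeal p Ω E) : ringOfIntegers p E) :
      ringOfIntegers p E ⧸ residueIdeal p Ω E) = 0 := by
    have := Fintype.ofFinite (ringOfIntegers p E ⧸ residueIdeal p Ω E)
    rw [map_natCast, Nat.card_eq_fintype_card, Nat.cast_card_eq_zero]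
  rw [Ideal.Quotient.eq_zero_iff_mem, mem_residueIdeal] at h
  simpa using h

lemma val_card_residue_sub_one :
    spectralVal p Ω ((Nat.card (ringOfIntegers p E ⧸ residueIdeal p Ω E) - 1 : ℕ) : Ω) = 1 := by
  rw [Nat.cast_sub Nat.card_pos, Nat.cast_one, ← Valuation.map_one (spectralVal p Ω),
    ← Valuation.map_neg (spectralVal p Ω) 1]
  apply Valuation.map_eq_of_sub_lt
  simpa using val_card_residue_lt_one

lemma val_pow_card_sub_one {y : E} (hy : spectralVal p Ω (algebraMap E Ω y) = 1) :
    spectralVal p Ω (algebraMap E Ω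
      (y ^ (Nat.card (ringOfIntegers p E ⧸ residueIdeal p Ω E) - 1) - 1)) < 1 := by
  let y' : ringOfIntegers p E := ⟨y, isIntegral_iff_le_one.2 hy.le⟩
  have hy' : Ideal.Quotient.mk (residueIdeal p Ω E) y' ≠ 0 := by
    rw [Ne, Ideal.Quotient.eq_zero_iff_mem, mem_residueIdeal]
    exact hy.not_lt
  have := Fintype.ofFinite (ringOfIntegers p E ⧸ residueIdeal p Ω E)
  have h := FiniteField.pow_card_sub_one_eq_one _ hy'
  rw [← map_pow, ← map_one (Ideal.Quotient.mk _), Ideal.Quotient.mk_eq_mk_iff_sub_mem,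
    mem_residueIdeal, ← Nat.card_eq_fintype_card] at h
  simpa [y'] using h

/-- A generator of the cyclic group of residues lifts to a root of unity by Hensel's lemma;
reduction shows that its order does not drop. -/
lemma exists_isPrimitiveRoot [IsAlgClosed Ω] :
    ∃ ξ : E, IsPrimitiveRoot ξ (Nat.card (ringOfIntegers p E ⧸ residueIdeal p Ω E) - 1) := by
  obtain ⟨g, hg⟩ := IsCyclic.exists_ofOrder_eq_natCard
    (α := (ringOfIntegers p E ⧸ residueIdeal p Ω E)ˣ)
  rw [Nat.card_units] at hg
  obtain ⟨y, hy⟩ := Ideal.Quotient.mk_surjective (g : ringOfIntegers p E ⧸ residueIdeal p Ω E)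
  have hvy : spectralVal p Ω (algebraMap E Ω y) = 1 := by
    refine le_antisymm (val_le_one y) (not_lt.1 fun h => ?_)
    have := Ideal.Quotient.eq_zero_iff_mem.2 (mem_residueIdeal.2 h)
    exact g.ne_zero (by rw [← hy, this])
  obtain ⟨ξ, hξ, hξy⟩ := (isConjInvariant_spectralVal (p := p) (Ω := Ω) ℚ_[p]).exists_pow_eq
    (val_card_residue_sub_one (E := E)) hvy (val_pow_card_sub_one hvy)
  refine ⟨ξ, hξ, fun l hl => ?_⟩
  have hξ1 : spectralVal p Ω (algebraMap E Ω ξ) = 1 := by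
    rw [← hvy]
    apply Valuation.map_eq_of_sub_lt
    rwa [hvy, ← map_sub]
  let ξ' : ringOfIntegers p E := ⟨ξ, isIntegral_iff_le_one.2 hξ1.le⟩
  have h1 : Ideal.Quotient.mk (residueIdeal p Ω E) ξ' = g := by
    rw [← hy, Ideal.Quotient.mk_eq_mk_iff_sub_mem, mem_residueIdeal]
    exact hξy
  have h2 : ξ' ^ l = 1 := Subtype.ext hl
  rw [← hg, orderOf_dvd_iff_pow_eq_one]
  ext
  rw [Units.val_pow_eq_pow_val, ← h1, ← map_pow, h2, map_one, Units.val_one]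

/-- When `p` generates the value group, the maximal ideal is `p 𝒪_E`, and `𝒪_E` is free over `ℤ_p`
of rank `[E : ℚ_p]`. -/
lemma HasValues.card_residue (h : HasValues E (spectralVal p Ω) (spectralVal p Ω (p : Ω))) :
    Nat.card (ringOfIntegers p E ⧸ residueIdeal p Ω E) = p ^ Module.finrank ℚ_[p] E := by
  have hI : residueIdeal p Ω E =
      (IsLocalRing.maximalIdeal ℤ_[p]).map (algebraMap ℤ_[p] (ringOfIntegers p E)) := by
    refine le_antisymm (fun x hx => ?_) map_maximalIdeal_le
    rw [PadicInt.maximalIdeal_eq_span_p, Ideal.map_span, Set.image_singleton, map_natCast,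
      Ideal.mem_span_singleton]
    obtain ⟨a, ha⟩ := exists_mul_p_iff.2 (h.le_of_lt_one hx)
    exact ⟨a, Subtype.ext (by simpa using ha)⟩
  have : Module.IsTorsionFree ℤ_[p] E := .trans_faithfulSMul ℤ_[p] ℚ_[p] E
  have : Module.Free ℤ_[p] (ringOfIntegers p E) :=
    IsIntegralClosure.module_free ℤ_[p] ℚ_[p] E _
  have hcard : Nat.card (ℤ_[p] ⧸ IsLocalRing.maximalIdeal ℤ_[p]) = p :=
    (Nat.card_congr (PadicInt.residueField (p := p)).toEquiv).trans (Nat.card_zmod p)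
  rw [hI, natCard_quotient_map_maximalIdeal, IsIntegralClosure.rank ℤ_[p] ℚ_[p] E, hcard]

end Residue

/-! ### Units of `K` modulo `p` and `q`-th powers -/

section BaseField

variable {p : ℕ} [Fact p.Prime] {Ω : Type*} [Field Ω] [Algebra ℚ_[p] Ω]
  [Algebra.IsAlgebraic ℚ_[p] Ω]
  {K : Type*} [Field K] [Algebra ℚ_[p] K] [Algebra ℤ_[p] K] [IsScalarTower ℤ_[p] ℚ_[p] K]
  [Algebra K Ω] [IsScalarTower ℚ_[p] K Ω]

lemma val_eq_of_spectralVal {x : K} {n : ℤ}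
    (hx : spectralVal p Ω (algebraMap K Ω x) = spectralVal p Ω (p : Ω) ^ n) : val p x = n := by
  have hc0 : 0 < spectralVal p Ω (p : Ω) := spectralVal_p_pos
  have hc1 : spectralVal p Ω (p : Ω) < 1 := spectralVal_p_lt_one
  have hp0 : (p : K) ≠ 0 := natCast_p_ne_zero
  have : {k : ℤ | ∃ a : ringOfIntegers p K, x = (p : K) ^ k * (a : K)} = Set.Iic n := by
    ext k
    rw [Set.mem_Iic, ← zpow_le_zpow_iff_right_of_lt_one₀ hc0 hc1, ← hx]
    constructor
    · rintro ⟨a, rfl⟩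
      rw [map_mul, map_mul, map_zpow₀, map_zpow₀, val_natCast_p]
      exact mul_le_of_le_one_right zero_le (val_le_one a)
    · intro h
      refine ⟨⟨x / (p : K) ^ k, ?_⟩, (mul_div_cancel₀ x (zpow_ne_zero k hp0)).symm⟩
      change IsIntegral _ _
      rw [isIntegral_iff_le_one (Ω := Ω), map_div₀, map_div₀, map_zpow₀, map_zpow₀, val_natCast_p]
      exact div_le_one_of_le₀ h zero_le
  rw [val, this, csSup_Iic]

lemma isPowModP_iff (hK : HasValues K (spectralVal p Ω) (spectralVal p Ω (p : Ω)))
    {q : ℕ} (hq : q ≠ 0) {x : K} (hx : spectralVal p Ω (algebraMap K Ω x) = 1) :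
    IsPowModP p q x ↔ ∃ d : K, spectralVal p Ω (algebraMap K Ω d) = 1 ∧
      spectralVal p Ω (algebraMap K Ω (x - d ^ q)) < 1 := by
  constructor
  · rintro ⟨d, a, h⟩
    have h1 : spectralVal p Ω (algebraMap K Ω (x - (d : K) ^ q)) < 1 :=
      (exists_mul_p_iff.1 ⟨a, by rw [h]; ring⟩).trans_lt spectralVal_p_lt_one
    refine ⟨d, ?_, h1⟩
    rw [← pow_eq_one_iff_of_nonneg zero_le hq, ← map_pow, ← map_pow, ← hx]
    apply Valuation.map_eq_of_sub_lt
    rwa [hx, Valuation.map_sub_swap, ← map_sub]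
  · rintro ⟨d, hd, h⟩
    obtain ⟨a, ha⟩ := exists_mul_p_iff.2 (hK.le_of_lt_one h)
    exact ⟨⟨d, isIntegral_iff_le_one.2 hd.le⟩, a, by rw [← ha]; ring⟩

variable [IsAlgClosed Ω] [FiniteDimensional ℚ_[p] K]

lemma coprime_pow_sub_one {m : ℕ} (hm : m ≠ 0) : p.Coprime (p ^ m - 1) := by
  have h1 : 1 ≤ p ^ m := Nat.one_le_pow _ _ (Fact.out : p.Prime).pos
  rw [(Fact.out : p.Prime).coprime_iff_not_dvd]
  intro h
  have h2 : p ∣ p ^ m := dvd_pow_self p hm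
  have : p ∣ 1 := by
    have := (Nat.dvd_sub h2 h)
    rwa [Nat.sub_sub_self h1] at this
  exact (Fact.out : p.Prime).one_lt.ne' (Nat.dvd_one.1 this)

/-- Every unit is congruent to a power of a primitive root of unity of the right order. -/
lemma HasValues.exists_val_sub_pow_lt
    (hK : HasValues K (spectralVal p Ω) (spectralVal p Ω (p : Ω)))
    {ζ : K} (hζ : IsPrimitiveRoot ζ (p ^ Module.finrank ℚ_[p] K - 1)) {y : K}
    (hy : spectralVal p Ω (algebraMap K Ω y) = 1) :
    ∃ j : ℤ, spectralVal p Ω (algebraMap K Ω (y - ζ ^ j)) < 1 := by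
  have hcop : p.Coprime (p ^ Module.finrank ℚ_[p] K - 1) :=
    coprime_pow_sub_one Module.finrank_pos.ne'
  have h := val_pow_card_sub_one hy
  rw [hK.card_residue] at h
  obtain ⟨x, hx, hxy⟩ := (isConjInvariant_spectralVal (p := p) (Ω := Ω) ℚ_[p]).exists_pow_eq
    (spectralVal_natCast_eq_one_iff.2 hcop) hy h
  have : NeZero (p ^ Module.finrank ℚ_[p] K - 1) := ⟨fun h0 => by
    rw [h0, Nat.coprime_zero_right] at hcop
    exact (Fact.out : p.Prime).one_lt.ne' hcop⟩
  obtain ⟨j, -, rfl⟩ := hζ.eq_pow_of_pow_eq_one hx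
  refine ⟨j, ?_⟩
  rw [zpow_natCast, map_sub, Valuation.map_sub_swap, ← map_sub]
  exact hxy

/-- Writing `y ≡ ζ^t`, the element `ζ^r y ≡ ζ^(r+t)` is a `q`-th power mod `p` exactly when `r + t ≡
q j` modulo the order `M` of `ζ` for some `j`, that is, when `gcd(q, M)` divides `r + t`. So `r₀ =
-t`. -/
lemma HasValues.exists_isPowModP_iff
    (hK : HasValues K (spectralVal p Ω) (spectralVal p Ω (p : Ω)))
    {ζ : K} (hζ : IsPrimitiveRoot ζ (p ^ Module.finrank ℚ_[p] K - 1)) {q : ℕ} (hq : q ≠ 0) {y : K}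
    (hy : spectralVal p Ω (algebraMap K Ω y) = 1) :
    ∃ r₀ : ℤ, ∀ r : ℤ, IsPowModP p q (ζ ^ r * y) ↔
      r ≡ r₀ [ZMOD (Nat.gcd q (p ^ Module.finrank ℚ_[p] K - 1) : ℕ)] := by
  set M := p ^ Module.finrank ℚ_[p] K - 1
  have hcop : p.Coprime M := coprime_pow_sub_one Module.finrank_pos.ne'
  have hM : spectralVal p Ω (M : Ω) = 1 := spectralVal_natCast_eq_one_iff.2 hcop
  have hM0 : M ≠ 0 := fun h0 => by
    rw [h0, Nat.coprime_zero_right] at hcop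
    exact (Fact.out : p.Prime).one_lt.ne' hcop
  have hζ1 : spectralVal p Ω (algebraMap K Ω ζ) = 1 := by
    rw [← pow_eq_one_iff_of_nonneg zero_le hM0, ← map_pow, ← map_pow, hζ.pow_eq_one, map_one,
      map_one]
  have hζ0 : ζ ≠ 0 := hζ.ne_zero hM0
  have hζz : ∀ j : ℤ, spectralVal p Ω (algebraMap K Ω (ζ ^ j)) = 1 := fun j => by
    rw [map_zpow₀, map_zpow₀, hζ1, one_zpow]
  have hy0 : y ≠ 0 := by rintro rfl; simp at hy
  have hdiv : ∀ a b : K, spectralVal p Ω (algebraMap K Ω b) = 1 →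
      (spectralVal p Ω (algebraMap K Ω (a - b)) < 1 ↔
        algebraMap K Ω (a / b) ∈ principalUnits (spectralVal p Ω)) := fun a b hb => by
    rw [map_div₀, div_mem_principalUnits_iff (ne_zero_of_val_eq_one hb), hb, map_sub]
  obtain ⟨t, ht⟩ := hK.exists_val_sub_pow_lt hζ hy
  rw [hdiv _ _ (hζz t)] at ht
  refine ⟨-t, fun r => ?_⟩
  have hx : spectralVal p Ω (algebraMap K Ω (ζ ^ r * y)) = 1 := by
    rw [map_mul, map_mul, hζz, hy, one_mul]
  have hdvd : r ≡ -t [ZMOD (Nat.gcd q M : ℕ)] ↔ ∃ j : ℤ, (M : ℤ) ∣ r + t - q * j := by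
    rw [Int.modEq_comm, Int.modEq_iff_dvd, sub_neg_eq_add]
    constructor
    · rintro ⟨k, hk⟩
      refine ⟨Nat.gcdA q M * k, Nat.gcdB q M * k, ?_⟩
      rw [hk, Nat.gcd_eq_gcd_ab]; ring
    · rintro ⟨j, k, hk⟩
      have h1 : ((Nat.gcd q M : ℕ) : ℤ) ∣ q := Int.natCast_dvd_natCast.2 (Nat.gcd_dvd_left _ _)
      have h2 : ((Nat.gcd q M : ℕ) : ℤ) ∣ M := Int.natCast_dvd_natCast.2 (Nat.gcd_dvd_right _ _)
      rw [show r + t = M * k + q * j by linarith]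
      exact dvd_add (h2.mul_right _) (h1.mul_right _)
  have hmem : ∀ j : ℤ, spectralVal p Ω (algebraMap K Ω (ζ ^ r * y - (ζ ^ j) ^ q)) < 1 ↔
      (M : ℤ) ∣ r + t - q * j := by
    intro j
    rw [← hζ.zpow_eq_one_iff_dvd, ← zpow_natCast (ζ ^ j), ← zpow_mul, hdiv _ _ (hζz _)]
    have hfac : ζ ^ r * y / ζ ^ (j * q) = ζ ^ (r + t - q * j) * (y / ζ ^ t) := by
      rw [zpow_sub₀ hζ0, zpow_add₀ hζ0, mul_comm j]
      have := zpow_ne_zero t hζ0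
      field_simp
    rw [hfac]
    constructor
    · intro h
      have h1 : algebraMap K Ω (ζ ^ (r + t - q * j)) ∈ principalUnits (spectralVal p Ω) := by
        have := mul_mem h (inv_mem_principalUnits ht)
        rwa [← map_inv₀, ← map_mul, mul_assoc, mul_inv_cancel₀, mul_one] at this
        exact div_ne_zero hy0 (zpow_ne_zero _ hζ0)
      apply (algebraMap K Ω).injective
      rw [map_one]
      refine eq_one_of_pow_eq_one hM ?_ h1
      rw [← map_pow, ← zpow_natCast, ← zpow_mul, mul_comm, zpow_mul, zpow_natCast, hζ.pow_eq_one,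
        one_zpow, map_one]
    · intro h
      rw [h, one_mul]
      exact ht
  rw [isPowModP_iff hK hq hx, hdvd]
  constructor
  · rintro ⟨d, hd, h⟩
    obtain ⟨j, hj⟩ := hK.exists_val_sub_pow_lt hζ hd
    refine ⟨j, (hmem j).1 ?_⟩
    have hdq : spectralVal p Ω (algebraMap K Ω (d ^ q)) = 1 := by
      rw [map_pow, map_pow, hd, one_pow]
    have hjq : spectralVal p Ω (algebraMap K Ω ((ζ ^ j) ^ q)) = 1 := by
      rw [map_pow, map_pow, hζz, one_pow]
    rw [hdiv _ _ hdq] at h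
    rw [hdiv _ _ (hζz j)] at hj
    rw [hdiv _ _ hjq]
    have : ζ ^ r * y / (ζ ^ j) ^ q = ζ ^ r * y / d ^ q * (d / ζ ^ j) ^ q := by
      have hd0 : d ≠ 0 := by rintro rfl; simp at hd
      have := zpow_ne_zero j hζ0
      rw [div_pow]
      field_simp
    rw [this, map_mul, map_pow]
    exact mul_mem h (pow_mem hj q)
  · rintro ⟨j, hj⟩
    exact ⟨ζ ^ j, hζz j, (hmem j).2 hj⟩

end BaseField

/-! ### The dichotomy between unramified and ramified extensions -/

section Extension

variable {p : ℕ} [Fact p.Prime] {K F Ω : Type*} [Field K] [Field F] [Field Ω]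
  [Algebra ℚ_[p] K] [Algebra ℤ_[p] K] [IsScalarTower ℤ_[p] ℚ_[p] K] [FiniteDimensional ℚ_[p] K]
  [Algebra ℚ_[p] F] [Algebra ℤ_[p] F] [IsScalarTower ℤ_[p] ℚ_[p] F] [FiniteDimensional ℚ_[p] F]
  [Algebra ℚ_[p] Ω] [Algebra.IsAlgebraic ℚ_[p] Ω] [IsAlgClosed Ω]
  [Algebra K F] [Algebra F Ω] [Algebra K Ω] [IsScalarTower K F Ω] [IsScalarTower ℚ_[p] K F]
  [IsScalarTower ℚ_[p] F Ω] [IsScalarTower ℚ_[p] K Ω] [IsScalarTower ℤ_[p] K F]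
  [FiniteDimensional K F]

variable (K Ω) in
/-- `F` is generated by a root of unity `η` of order prime to `p` whose conjugates are pairwise
incongruent. -/
def IsGenByRootOfUnity (p : ℕ) [Fact p.Prime] [Algebra ℚ_[p] Ω] [Algebra.IsAlgebraic ℚ_[p] Ω]
    (η : F) : Prop :=
  K⟮η⟯ = ⊤ ∧ (∃ n : ℕ, p.Coprime n ∧ η ^ n = 1) ∧
    ∀ σ τ : F →ₐ[K] Ω, σ ≠ τ → spectralVal p Ω (σ η - τ η) = 1

omit [Algebra ℤ_[p] K] [IsScalarTower ℤ_[p] ℚ_[p] K] [FiniteDimensional ℚ_[p] K]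
  [IsScalarTower ℚ_[p] K F] [IsScalarTower ℤ_[p] K F] in
/-- An extension of prime degree is generated either by a root of unity of order prime to `p` or by
an element whose value is not in the value group of `K`. -/
lemma HasValues.unramified_or_ramified
    (hK : HasValues K (spectralVal p Ω) (spectralVal p Ω (p : Ω)))
    (hF : (Module.finrank K F).Prime) {θ : F} (hθ : θ ∉ Set.range (algebraMap K F)) :
    ((∃ η : F, IsGenByRootOfUnity K Ω p η) ∧
      ∃ k : ℤ, spectralVal p Ω (diffProd K Ω θ) = spectralVal p Ω (p : Ω) ^
        (k * (Module.finrank K F * ((Module.finrank K F : ℤ) - 1)))) ∨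
    ∃ (a : K) (s : ℤ), spectralVal p Ω (algebraMap F Ω (θ - algebraMap K F a)) ^
      Module.finrank K F = spectralVal p Ω (p : Ω) ^ s ∧ ¬ (Module.finrank K F : ℤ) ∣ s := by
  have : Algebra.IsAlgebraic K Ω := Algebra.IsAlgebraic.tower_top (K := ℚ_[p]) K
  have : CharZero K := charZero_of_injective_algebraMap (algebraMap ℚ_[p] K).injective
  have hv := isConjInvariant_spectralVal (p := p) (Ω := Ω) K
  have hc0 : 0 < spectralVal p Ω (p : Ω) := spectralVal_p_pos
  have hc1 : spectralVal p Ω (p : Ω) < 1 := spectralVal_p_lt_one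
  obtain ⟨a, ha⟩ := hK.exists_best_approx hv hc0 hc1 hθ
  have hx0 : θ - algebraMap K F a ≠ 0 := fun h => hθ ⟨a, (sub_eq_zero.1 h).symm⟩
  obtain ⟨s, hs⟩ := hK.exists_pow_finrank hv hx0
  by_cases hdvd : (Module.finrank K F : ℤ) ∣ s
  swap
  · exact Or.inr ⟨a, s, hs, hdvd⟩
  left
  obtain ⟨k, rfl⟩ := hdvd
  rw [mul_comm, zpow_mul, zpow_natCast, pow_left_inj₀ zero_le zero_le hF.ne_zero] at hs
  set x := θ - algebraMap K F a with hx
  have hp0 : (p : K) ≠ 0 := natCast_p_ne_zero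
  have hpk : algebraMap K F ((p : K) ^ k) ≠ 0 := by rw [_root_.map_ne_zero]; exact zpow_ne_zero k hp0
  have hvpk : spectralVal p Ω (algebraMap F Ω (algebraMap K F ((p : K) ^ k))) =
      spectralVal p Ω (p : Ω) ^ k := by
    rw [← IsScalarTower.algebraMap_apply, map_zpow₀, map_zpow₀, val_natCast_p]
  set w := x / algebraMap K F ((p : K) ^ k) with hw
  have hxw : x = algebraMap K F ((p : K) ^ k) * w := (mul_div_cancel₀ x hpk).symm
  have hvw : spectralVal p Ω (algebraMap F Ω w) = 1 := by
    rw [hw, map_div₀, map_div₀, hvpk, hs, div_self (zpow_pos hc0 k).ne']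
  -- An element of `K` congruent to `w` would improve the best approximation `a`.
  have hwK : ∀ b : K, 1 ≤ spectralVal p Ω (algebraMap F Ω (w - algebraMap K F b)) := by
    intro b
    have h1 := ha (a + p ^ k * b)
    rw [show θ - algebraMap K F (a + p ^ k * b) =
      algebraMap K F ((p : K) ^ k) * (w - algebraMap K F b) by
        rw [mul_sub, ← hxw, hx, map_add, map_mul]; ring,
      hs, map_mul, map_mul, hvpk] at h1
    exact le_of_mul_le_mul_left (by simpa using h1) (zpow_pos hc0 k)
  obtain ⟨η, hη, htop, hd, hwd⟩ := hv.exists_rootOfUnity hF hvw hwK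
    (val_card_residue_sub_one (E := F)) (val_pow_card_sub_one hvw)
  refine ⟨⟨η, htop, ⟨_, spectralVal_natCast_eq_one_iff.1 (val_card_residue_sub_one (Ω := Ω)), hη⟩,
    hd⟩, k, ?_⟩
  rw [← diffProd_sub_algebraMap θ a, ← hx, hxw, diffProd_algebraMap_mul, map_mul, map_pow,
    val_diffProd hwd, one_pow, mul_one, map_zpow₀, map_zpow₀, val_natCast_p, zpow_mul,
    ← zpow_natCast]
  congr 1
  push_cast [Nat.cast_sub hF.one_le]
  rfl

omit [Algebra ℚ_[p] K] [IsScalarTower ℤ_[p] ℚ_[p] K] [FiniteDimensional ℚ_[p] K] [IsAlgClosed Ω]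
  [Algebra K Ω] [IsScalarTower K F Ω] [IsScalarTower ℚ_[p] K F] [IsScalarTower ℚ_[p] K Ω]
  [FiniteDimensional K F] in
/-- Unramified extensions of unramified extensions of `ℚ_p` have value group generated by `p`. -/
lemma IsUnramifiedExt.hasValues (hK : IsUnramifiedExt ℤ_[p] K)
    (hF : IsUnramifiedExt (ringOfIntegers p K) F) :
    HasValues F (spectralVal p Ω) (spectralVal p Ω (p : Ω)) := by
  have h1 : Algebra.FormallyUnramified ℤ_[p] (ringOfIntegers p K) := hK
  have h2 : Algebra.FormallyUnramified (ringOfIntegers p K)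
    (integralClosure (ringOfIntegers p K) F) := hF
  have : IsScalarTower ℤ_[p] (ringOfIntegers p K) F := .of_algebraMap_eq fun a => by
    rw [IsScalarTower.algebraMap_apply ℤ_[p] K F]; rfl
  have : IsIntegralClosure (integralClosure (ringOfIntegers p K) F) ℤ_[p] F :=
    { algebraMap_injective := Subtype.val_injective
      isIntegral_iff := fun {x} => by
        refine ⟨fun h => ⟨⟨x, h.tower_top⟩, rfl⟩, ?_⟩
        rintro ⟨y, rfl⟩
        exact isIntegral_trans (A := ringOfIntegers p K) _ y.2 }
  have := Algebra.FormallyUnramified.comp ℤ_[p] (ringOfIntegers p K)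
    (integralClosure (ringOfIntegers p K) F)
  exact hasValues_of_formallyUnramified (integralClosure (ringOfIntegers p K) F)

omit [Algebra ℚ_[p] F] [Algebra ℤ_[p] F] [IsScalarTower ℤ_[p] ℚ_[p] F] [FiniteDimensional ℚ_[p] F]
  [Algebra F Ω] [IsScalarTower K F Ω] [IsScalarTower ℚ_[p] K F] [IsScalarTower ℚ_[p] F Ω]
  [IsScalarTower ℤ_[p] K F] in
-- The discriminant of the powers of `η` is a unit, so the integral closure is `A[η]` with `A =
-- 𝒪_K`. Differentiating `η^n = 1`, with `n` invertible in `A`, gives `dη = 0`, so all Kähler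
-- differentials vanish.
lemma IsGenByRootOfUnity.isUnramifiedExt {η : F} (hη : IsGenByRootOfUnity K Ω p η) :
    IsUnramifiedExt (ringOfIntegers p K) F := by
  obtain ⟨htop, ⟨n, hn, hηn⟩, hd⟩ := hη
  have : CharZero K := charZero_of_injective_algebraMap (algebraMap ℚ_[p] K).injective
  have : IsFractionRing (ringOfIntegers p K) K :=
    integralClosure.isFractionRing_of_finite_extension ℚ_[p] K
  have : IsIntegrallyClosed (ringOfIntegers p K) :=
    integralClosure.isIntegrallyClosedOfFiniteExtension ℚ_[p]
  have hn0 : n ≠ 0 := by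
    rintro rfl
    exact (Fact.out : p.Prime).one_lt.ne' (by simpa using hn)
  set A := ringOfIntegers p K
  have hηint : IsIntegral A η :=
    .of_pow (Nat.pos_of_ne_zero hn0) (by rw [hηn]; exact isIntegral_one)
  obtain ⟨pb, hgen, hdim⟩ := exists_powerBasis htop
  have hdisc : spectralVal p Ω (algebraMap K Ω (Algebra.discr K pb.basis)) = 1 := by
    let e : Fin pb.dim ≃ (F →ₐ[K] Ω) := Fintype.equivOfCardEq (by
      rw [Fintype.card_fin, AlgHom.card K F Ω, hdim])
    rw [Algebra.discr_powerBasis_eq_prod K Ω pb e, map_prod]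
    refine Finset.prod_eq_one fun i _ => ?_
    rw [map_prod]
    refine Finset.prod_eq_one fun j hj => ?_
    rw [map_pow, hgen, hd _ _ (e.injective.ne (Finset.mem_Ioi.1 hj).ne'), one_pow]
  have hdisc0 : Algebra.discr K pb.basis ≠ 0 := fun h => by rw [h] at hdisc; simp at hdisc
  let δ : A := ⟨(Algebra.discr K pb.basis)⁻¹, (isIntegral_iff_le_one (Ω := Ω)).2 (by
    rw [map_inv₀, map_inv₀, hdisc, inv_one])⟩
  have hadj : ∀ y : F, IsIntegral A y → y ∈ Algebra.adjoin A {η} := by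
    intro y hy
    have h1 := Algebra.discr_mul_isIntegral_mem_adjoin K (B := pb) (by rwa [hgen]) hy
    rw [hgen] at h1
    have h2 := Subalgebra.smul_mem _ h1 δ
    have h3 : δ • Algebra.discr K pb.basis • y = y := by
      change (Algebra.discr K pb.basis)⁻¹ • Algebra.discr K pb.basis • y = y
      rw [smul_smul, inv_mul_cancel₀ hdisc0, one_smul]
    rwa [h3] at h2
  let η' : integralClosure A F := ⟨η, hηint⟩
  have hη'n : η' ^ n = 1 := Subtype.ext hηn
  have hadj' : Algebra.adjoin A {η'} = ⊤ := by
    rw [eq_top_iff]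
    intro y _
    have h1 : (y : F) ∈ (Algebra.adjoin A {η'}).map (integralClosure A F).val := by
      rw [AlgHom.map_adjoin, Set.image_singleton]
      exact hadj y y.2
    obtain ⟨z, hz, hzy⟩ := h1
    rwa [← Subtype.ext (a1 := z) (a2 := y) hzy]
  have hnu : IsUnit (n : integralClosure A F) := by
    have hnK : (n : K) ≠ 0 := Nat.cast_ne_zero.2 hn0
    have hnA : IsUnit (n : A) := by
      refine IsUnit.of_mul_eq_one ⟨(n : K)⁻¹, (isIntegral_iff_le_one (Ω := Ω)).2 ?_⟩
        (Subtype.ext ?_)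
      · rw [map_inv₀, map_inv₀, map_natCast, spectralVal_natCast_eq_one_iff.2 hn, inv_one]
      · simp [hnK]
    simpa using hnA.map (algebraMap A (integralClosure A F))
  have hDη : KaehlerDifferential.D A (integralClosure A F) η' = 0 := by
    have h1 := (KaehlerDifferential.D A (integralClosure A F)).leibniz_pow η' n
    rw [hη'n, Derivation.map_one_eq_zero, ← Nat.cast_smul_eq_nsmul (integralClosure A F),
      smul_smul] at h1
    have hu : IsUnit ((n : integralClosure A F) * η' ^ (n - 1)) :=
      hnu.mul ((IsUnit.of_pow_eq_one hη'n hn0).pow _)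
    exact (hu.smul_eq_zero).1 h1.symm
  have hD : KaehlerDifferential.D A (integralClosure A F) = 0 :=
    Derivation.ext_of_adjoin_eq_top {η'} hadj' (by
      intro y hy
      rw [Set.mem_singleton_iff.1 hy, hDη, Derivation.zero_apply])
  refine ⟨?_⟩
  rw [← Submodule.subsingleton_iff (integralClosure A F), ← subsingleton_iff_bot_eq_top,
    ← KaehlerDifferential.span_range_derivation, hD, eq_comm, Submodule.span_eq_bot]
  rintro _ ⟨y, rfl⟩
  simp

end Extension

/-! ### Uniqueness of the unramified extension of degree `q` -/

section Uniqueness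

variable {p : ℕ} [Fact p.Prime] {K Ω : Type*} [Field K] [Field Ω]
  [Algebra ℚ_[p] K] [Algebra ℤ_[p] K] [IsScalarTower ℤ_[p] ℚ_[p] K] [FiniteDimensional ℚ_[p] K]
  [Algebra ℚ_[p] Ω] [Algebra ℤ_[p] Ω] [Algebra.IsAlgebraic ℚ_[p] Ω] [IsAlgClosed Ω]
  [Algebra K Ω] [IsScalarTower ℚ_[p] K Ω] [IsScalarTower ℤ_[p] K Ω]

omit [IsAlgClosed Ω] [FiniteDimensional ℚ_[p] K] [Algebra ℤ_[p] Ω] [IsScalarTower ℤ_[p] K Ω]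
  [Algebra.IsAlgebraic ℚ_[p] Ω] [Algebra ℤ_[p] K] [IsScalarTower ℤ_[p] ℚ_[p] K] in
instance (L : IntermediateField K Ω) : IsScalarTower ℚ_[p] L Ω :=
  .of_algebraMap_eq fun a => by
    rw [IsScalarTower.algebraMap_apply ℚ_[p] K L, ← IsScalarTower.algebraMap_apply K L Ω,
      IsScalarTower.algebraMap_apply ℚ_[p] K Ω]

omit [IsAlgClosed Ω] [FiniteDimensional ℚ_[p] K] [Algebra.IsAlgebraic ℚ_[p] Ω] in
instance (L : IntermediateField K Ω) : IsScalarTower ℤ_[p] ℚ_[p] L :=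
  .of_algebraMap_eq fun a => by
    rw [IsScalarTower.algebraMap_apply ℤ_[p] K L, IsScalarTower.algebraMap_apply ℚ_[p] K L,
      IsScalarTower.algebraMap_apply ℤ_[p] ℚ_[p] K]

/-- Two extensions of the same prime degree in which `p` remains a uniformizer coincide. -/
lemma HasValues.intermediateField_eq
    (hK : HasValues K (spectralVal p Ω) (spectralVal p Ω (p : Ω))) {L₁ L₂ : IntermediateField K Ω}
    (hdeg : Module.finrank K L₂ = Module.finrank K L₁) (hL : (Module.finrank K L₁).Prime)
    (h₁ : HasValues L₁ (spectralVal p Ω) (spectralVal p Ω (p : Ω)))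
    (h₂ : HasValues L₂ (spectralVal p Ω) (spectralVal p Ω (p : Ω))) : L₂ = L₁ := by
  have hL₂ : (Module.finrank K L₂).Prime := hdeg ▸ hL
  have : FiniteDimensional K L₁ := Module.finite_of_finrank_pos hL.pos
  have : FiniteDimensional K L₂ := Module.finite_of_finrank_pos hL₂.pos
  have : FiniteDimensional ℚ_[p] L₁ := FiniteDimensional.trans ℚ_[p] K L₁
  have : FiniteDimensional ℚ_[p] L₂ := FiniteDimensional.trans ℚ_[p] K L₂
  have hc0 : 0 < spectralVal p Ω (p : Ω) := spectralVal_p_pos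
  have hc1 : spectralVal p Ω (p : Ω) < 1 := spectralVal_p_lt_one
  obtain ⟨θ, hθ⟩ : ∃ θ : L₂, θ ∉ Set.range (algebraMap K L₂) := by
    by_contra! h
    have : (⊥ : IntermediateField K L₂) = ⊤ := eq_top_iff.2 fun x _ => mem_bot.2 (h x)
    have h1 := IntermediateField.finrank_bot (F := K) (E := L₂)
    rw [this, IntermediateField.finrank_top'] at h1
    exact hL₂.one_lt.ne' h1
  obtain ⟨η, htop, ⟨n, hn, hηn⟩, -⟩ : ∃ η : L₂, IsGenByRootOfUnity K Ω p η := by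
    rcases hK.unramified_or_ramified (Ω := Ω) hL₂ hθ with h | ⟨a, s, hs, hdvd⟩
    · exact h.1
    · exact absurd (h₂.dvd_of_pow_eq hc0 hc1 hL₂.ne_zero hs) hdvd
  set M := p ^ Module.finrank ℚ_[p] L₁ - 1 with hM
  have hfin : Module.finrank ℚ_[p] L₂ = Module.finrank ℚ_[p] L₁ := by
    rw [← Module.finrank_mul_finrank ℚ_[p] K L₂, hdeg, Module.finrank_mul_finrank]
  have hη1 : spectralVal p Ω (algebraMap L₂ Ω η) = 1 := by
    have hn0 : n ≠ 0 := by
      rintro rfl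
      exact (Fact.out : p.Prime).one_lt.ne' (by simpa using hn)
    rw [← pow_eq_one_iff_of_nonneg zero_le hn0, ← map_pow, ← map_pow, hηn, map_one, map_one]
  -- `η^M ≡ 1` because `L₂` has `M + 1` residues; as `η^M` is also an `n`-th root of unity with `n`
  -- prime to `p`, it equals `1`. All `M`-th roots of unity lie in `L₁`, whose residue field has the
  -- same size.
  have hηM : algebraMap L₂ Ω η ^ M = 1 := by
    have h := val_pow_card_sub_one hη1
    rw [h₂.card_residue, hfin, map_sub, map_one, map_pow] at h
    refine eq_one_of_pow_eq_one (spectralVal_natCast_eq_one_iff.2 hn) ?_ h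
    rw [← pow_mul, mul_comm, pow_mul, ← map_pow, hηn, map_one, one_pow]
  obtain ⟨ξ, hξ⟩ := exists_isPrimitiveRoot (p := p) (Ω := Ω) (E := L₁)
  rw [h₁.card_residue, ← hM] at hξ
  have : NeZero M := ⟨fun h0 => by
    have hcop : p.Coprime M := coprime_pow_sub_one Module.finrank_pos.ne'
    rw [h0, Nat.coprime_zero_right] at hcop
    exact (Fact.out : p.Prime).one_lt.ne' hcop⟩
  obtain ⟨j, -, hj⟩ := (hξ.map_of_injective (algebraMap L₁ Ω).injective).eq_pow_of_pow_eq_one hηM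
  have hmem : (η : Ω) ∈ L₁ := by
    change algebraMap L₂ Ω η ∈ L₁
    rw [← hj, ← map_pow]
    exact (ξ ^ j).2
  have hle : L₂ ≤ L₁ := by
    have h : K⟮η⟯ ≤ L₁.comap L₂.val := adjoin_simple_le_iff.2 hmem
    rw [htop] at h
    exact fun y hy => h (x := ⟨y, hy⟩) mem_top
  exact eq_of_le_of_finrank_eq hle hdeg

end Uniqueness

end PadicExt

/-! ### The main theorem -/

open PadicExt in
theorem mainTheorem1 (p q m : ℕ) [Fact p.Prime] (hq : q.Prime) (hpq : p ≠ q)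
    (K : Type*) [Field K] [Algebra ℚ_[p] K] [Algebra ℤ_[p] K] [IsScalarTower ℤ_[p] ℚ_[p] K]
    [FiniteDimensional ℚ_[p] K] (hm : Module.finrank ℚ_[p] K = m)
    (hK : PadicExt.IsUnramifiedExt ℤ_[p] K)
    (ζ : K) (hζ : IsPrimitiveRoot ζ (p ^ m - 1))
    (f : (PadicExt.ringOfIntegers p K)[X])
    (hf : Irreducible (f.map (algebraMap (PadicExt.ringOfIntegers p K) K)))
    (hdeg : f.natDegree = q)
    (θ : AlgebraicClosure K)
    (hθ : aeval θ (f.map (algebraMap (PadicExt.ringOfIntegers p K) K)) = 0)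
    (Δ u : K) (hΔ : Δ = PadicExt.rootDiscr (f.map (algebraMap (PadicExt.ringOfIntegers p K) K)))
    (hu : u = PadicExt.unitPart p Δ) (v : ℤ) (hv : v = PadicExt.val p Δ) :
    ((q : ℤ) * ((q : ℤ) - 1) ∣ v ↔
      Module.finrank K K⟮θ⟯ = q ∧
      PadicExt.IsUnramifiedExt (PadicExt.ringOfIntegers p K) K⟮θ⟯ ∧
      ∀ L : IntermediateField K (AlgebraicClosure K), Module.finrank K L = q →
        PadicExt.IsUnramifiedExt (PadicExt.ringOfIntegers p K) L → L = K⟮θ⟯) ∧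
    (¬ (q : ℤ) * ((q : ℤ) - 1) ∣ v →
      (q : ℤ) - 1 ∣ v ∧ IsCoprime (v / ((q : ℤ) - 1)) (q : ℤ) ∧
      ∀ ℓ : ℤ, v / ((q : ℤ) - 1) * ℓ ≡ 1 [ZMOD q] →
        (∃ r₀ : ℤ, ∀ r : ℤ, PadicExt.IsPowModP p q (ζ ^ r * u ^ ℓ) ↔
          r ≡ r₀ [ZMOD (Nat.gcd q (p ^ m - 1) : ℕ)]) ∧
        ∀ r : ℤ, PadicExt.IsPowModP p q (ζ ^ r * u ^ ℓ) →
          ∀ α : AlgebraicClosure K, α ^ q = algebraMap K (AlgebraicClosure K) (ζ ^ r * (p : K)) →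
            Nonempty (K⟮θ⟯ ≃ₐ[K] K⟮α⟯)) := by
  subst hm
  have : Algebra.IsAlgebraic ℚ_[p] (AlgebraicClosure K) := Algebra.IsAlgebraic.trans ℚ_[p] K _
  have : CharZero K := charZero_of_injective_algebraMap (algebraMap ℚ_[p] K).injective
  have hKu : Algebra.FormallyUnramified ℤ_[p] (integralClosure ℤ_[p] K) := hK
  set w := spectralVal p (AlgebraicClosure K)
  set c := w (p : AlgebraicClosure K) with hc
  have hc0 : 0 < c := spectralVal_p_pos
  have hc1 : c < 1 := spectralVal_p_lt_one
  have hKv : HasValues K w c := hasValues_of_formallyUnramified (integralClosure ℤ_[p] K)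
  have hw : IsConjInvariant w K := isConjInvariant_spectralVal K
  have hwq : w (q : AlgebraicClosure K) = 1 := spectralVal_natCast_eq_one_iff.2
    ((Nat.coprime_primes Fact.out hq).2 hpq)
  have hθint : IsIntegral K θ := Algebra.IsIntegral.isIntegral θ
  have hmin := minpoly.eq_of_irreducible hf hθ
  have hfin : Module.finrank K K⟮θ⟯ = q := by
    rw [adjoin.finrank hθint, ← hmin,
      natDegree_mul_C (inv_ne_zero (leadingCoeff_ne_zero.2 hf.ne_zero)),
      natDegree_map_eq_of_injective Subtype.val_injective, hdeg]
  have hFp : (Module.finrank K K⟮θ⟯).Prime := hfin.symm ▸ hq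
  have : FiniteDimensional K K⟮θ⟯ := adjoin.finiteDimensional hθint
  have : FiniteDimensional ℚ_[p] K⟮θ⟯ := FiniteDimensional.trans ℚ_[p] K _
  set t : K⟮θ⟯ := AdjoinSimple.gen K θ with ht
  have htK : t ∉ Set.range (algebraMap K K⟮θ⟯) := by
    rintro ⟨a, ha⟩
    have h1 : K⟮θ⟯ = ⊥ := by
      rw [adjoin_simple_eq_bot_iff, mem_bot]
      exact ⟨a, congrArg (algebraMap K⟮θ⟯ (AlgebraicClosure K)) ha⟩
    rw [h1, IntermediateField.finrank_bot] at hfin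
    exact hq.one_lt.ne hfin
  have hΔt : Δ = (minpoly K t).discr := by
    rw [hΔ, rootDiscr, mul_comm, hmin, ht, minpoly_gen]
  have hΔd := algebraMap_discr_minpoly (Ω := AlgebraicClosure K) (adjoin_eq_top_of_notMem_range hFp htK)
  rw [← hΔt] at hΔd
  have hq1 : (q : ℤ) - 1 ≠ 0 := sub_ne_zero.2 (by exact_mod_cast hq.one_lt.ne')
  rcases hKv.unramified_or_ramified (Ω := AlgebraicClosure K) hFp htK with
    ⟨⟨η, hη⟩, k, hk⟩ | ⟨a, s, hs, hdvd⟩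
  · have hval : v = k * (q * ((q : ℤ) - 1)) := by
      rw [hv]
      apply val_eq_of_spectralVal (Ω := AlgebraicClosure K)
      rw [hΔd, map_mul, hk, hfin]
      simp
    have hdvd : (q : ℤ) * ((q : ℤ) - 1) ∣ v := ⟨k, by rw [hval, mul_comm]⟩
    refine ⟨⟨fun _ => ⟨hfin, hη.isUnramifiedExt, fun L hL hLu => ?_⟩, fun _ => hdvd⟩,
      fun h => absurd hdvd h⟩
    have : FiniteDimensional K L := Module.finite_of_finrank_pos (hL ▸ hq.pos)
    have : FiniteDimensional ℚ_[p] L := FiniteDimensional.trans ℚ_[p] K _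
    exact hKv.intermediateField_eq (hL.trans hfin.symm) hFp
      (hK.hasValues hη.isUnramifiedExt) (hK.hasValues hLu)
  · rw [← diffProd_sub_algebraMap t a] at hΔd
    obtain ⟨β, b, e, u', hb, he, hu', hβ, hD, hmem⟩ := hKv.exists_radical_discr hw hc0 hc1 hFp
      (by rw [hfin]; exact hwq) hs hdvd (π := (p : K)) val_natCast_p hΔd
    have hval : v = s * ((q : ℤ) - 1) := by
      rw [hv]
      apply val_eq_of_spectralVal (Ω := AlgebraicClosure K)
      rw [hD, map_mul, map_mul, hu', mul_one, map_zpow₀, map_zpow₀, val_natCast_p, hfin]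
    have huu : u = u' := by
      rw [hu, unitPart, ← hv, hval, hD, hfin, ← mul_assoc, ← zpow_add₀ natCast_p_ne_zero,
        neg_add_cancel, zpow_zero, one_mul]
    rw [hfin] at hdvd
    have hndvd : ¬ (q : ℤ) * ((q : ℤ) - 1) ∣ v := by
      rw [hval]
      exact fun h => hdvd (Int.dvd_of_mul_dvd_mul_right hq1 h)
    refine ⟨⟨fun h => absurd h hndvd, fun ⟨_, hu, _⟩ => ?_⟩, fun _ => ?_⟩
    -- If `F` were unramified over `K`, its values would be powers of `c`, forcing `q ∣ s`.
    · have hFv : HasValues K⟮θ⟯ w c := hK.hasValues hu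
      rw [hfin] at hs
      exact absurd (hFv.dvd_of_pow_eq hc0 hc1 hq.ne_zero hs) hdvd
    have hdiv : v / ((q : ℤ) - 1) = s := by rw [hval, Int.mul_ediv_cancel _ hq1]
    rw [hdiv]
    refine ⟨⟨s, by rw [hval, mul_comm]⟩, ?_, fun ℓ hℓ => ⟨?_, fun r hr α hα => ?_⟩⟩
    · exact ((Nat.prime_iff_prime_int.1 hq).coprime_iff_not_dvd.2 hdvd).symm
    · refine hKv.exists_isPowModP_iff hζ hq.ne_zero ?_
      rw [huu, map_zpow₀, map_zpow₀, hu', one_zpow]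
    have hM0 : p ^ Module.finrank ℚ_[p] K - 1 ≠ 0 :=
      (Nat.sub_pos_of_lt (Nat.one_lt_pow Module.finrank_pos.ne' (Fact.out : p.Prime).one_lt)).ne'
    have hg : w (algebraMap K (AlgebraicClosure K) (ζ ^ r)) = 1 := by
      rw [← pow_eq_one_iff_of_nonneg zero_le hM0, ← map_pow, ← map_pow, ← zpow_natCast,
        ← zpow_mul, mul_comm, zpow_mul, zpow_natCast, hζ.pow_eq_one, one_zpow, map_one, map_one]
    obtain ⟨d, hd, hr'⟩ := (isPowModP_iff hKv hq.ne_zero (by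
      rw [huu, map_mul, map_mul, hg, map_zpow₀, map_zpow₀, hu', one_zpow, one_mul])).1 hr
    obtain ⟨α', hα'top, hα'⟩ := hKv.exists_radical_eq hw hc0 hc1 hFp (by rw [hfin]; exact hwq)
      (π := (p : K)) val_natCast_p hb he hβ hmem (by rwa [hfin]) hg hd (by rwa [hfin, ← huu])
    -- The generator `α'` of `K(θ)` has minimal polynomial `X^q - ζ^r p`, of which `α` is a root;
    -- this is why any choice of the root works.
    refine nonempty_algEquiv_adjoin_of_aeval_eq_zero hα'top ?_
    rw [minpoly_of_pow_eq hα'top hα', hfin]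
    simp [hα]
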